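/- Let $\alpha>0$ and $x\in(0,1)$. For $n\in\mathbb N=\{1,2,\dots\}$ let $\mu_{\alpha,x}^{(n)}$ be the $\alpha$-fractional binomial distribution, that is, the probability measure on $\{0,1,\dots,n\}$ given by $$\mu_{\alpha,x}^{(n)}=\frac{\alpha}{Z_{\alpha,x}^{(n)}}\sum_{j=0}^n\binom{\alpha n}{\alpha j}x^{\alpha j}(1-x)^{\alpha(n-j)}\delta_j,\qquad Z_{\alpha,x}^{(n)}=\alpha\sum_{j=0}^n\binom{\alpha n}{\alpha j}x^{\alpha j}(1-x)^{\alpha(n-j)},$$ where $\binom{w}{z}=\frac{\Gamma(w+1)}{\Gamma(z+1)\Gamma(w-z+1)}$ and $\delta_j$ is the Dirac measure at $j$. Let $S_{\alpha,x}^{(n)}$ be a random variable with law $\mu_{\alpha,x}^{(n)}$, let $$\widetilde F_{\alpha,x}^{(n)}(z)=\mathbb P\left(\frac{S_{\alpha,x}^{(n)}-\mathbb E[S_{\alpha,x}^{(n)}]}{\sqrt{\mathrm{Var}(S_{\alpha,x}^{(n)})}}\le z\right),\qquad z\in\mathbb R,$$ and let $\Phi(z)=\int_{-\infty}^z\frac{1}{\sqrt{2\pi}}e^{-u^2/2}\,\mathrm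 du$. Then there is a constant $C>0$, depending only on $\alpha$ and $x$, such that $$\sup_{z\in\mathbb R}\left|\widetilde F_{\alpha,x}^{(n)}(z)-\Phi(z)\right|\le\frac{C}{\sqrt n}\qquad\text{for all }n\in\mathbb N.$$ -/

import Mathlib

open MeasureTheory ProbabilityTheory

noncomputable section

/-- The generalized binomial coefficient `Γ(w+1) / (Γ(z+1) Γ(w-z+1))` for real arguments. At a pole
of a Gamma factor in the denominator Mathlib's value `0` of `Real.Gamma` and `a / 0 = 0` give `0`,
the usual convention. -/
def genBinom (w z : ℝ) : ℝ :=
  Real.Gamma (w + 1) / (Real.Gamma (z + 1) * Real.Gamma (w - z + 1))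

/-- The unnormalized weight of the point `j` (the powers are real powers, with `0 ^ 0 = 1`). -/
def fracBinomWeight (α x : ℝ) (n j : ℕ) : ℝ :=
  genBinom (α * n) (α * j) * x ^ (α * (j : ℝ)) * (1 - x) ^ (α * ((n : ℝ) - j))

/-- The normalizing constant. -/
def fracBinomZ (α x : ℝ) (n : ℕ) : ℝ :=
  α * ∑ j ∈ Finset.range (n + 1), fracBinomWeight α x n j

/-- The `α`-fractional binomial distribution on `{0, 1, …, n}`, as a measure on `ℝ`. -/
def fracBinom (α x : ℝ) (n : ℕ) : Measure ℝ :=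
  ∑ j ∈ Finset.range (n + 1),
    ENNReal.ofReal (α / fracBinomZ α x n * fracBinomWeight α x n j) • Measure.dirac (j : ℝ)

lemma genBinom_pos {α : ℝ} (hα : 0 < α) {n j : ℕ} (hj : j ≤ n) :
    0 < genBinom (α * n) (α * j) := by
  have h : α * (j : ℝ) ≤ α * n := by gcongr
  have h0 : 0 ≤ α * (j : ℝ) := by positivity
  unfold genBinom
  have h1 := Real.Gamma_pos_of_pos (show 0 < α * (n : ℝ) + 1 by linarith)
  have h2 := Real.Gamma_pos_of_pos (show 0 < α * (j : ℝ) + 1 by linarith)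
  have h3 := Real.Gamma_pos_of_pos (show 0 < α * (n : ℝ) - α * j + 1 by linarith)
  positivity

lemma fracBinomWeight_nonneg {α x : ℝ} (hα : 0 < α) (hx : x ∈ Set.Icc (0 : ℝ) 1) {n j : ℕ}
    (hj : j ≤ n) : 0 ≤ fracBinomWeight α x n j :=
  mul_nonneg (mul_nonneg (genBinom_pos hα hj).le (Real.rpow_nonneg hx.1 _))
    (Real.rpow_nonneg (by linarith [hx.2]) _)

lemma fracBinomZ_pos {α x : ℝ} (hα : 0 < α) (hx : x ∈ Set.Icc (0 : ℝ) 1) (n : ℕ) :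
    0 < fracBinomZ α x n := by
  refine mul_pos hα (Finset.sum_pos' (fun j hj => fracBinomWeight_nonneg hα hx
    (Nat.lt_succ_iff.mp (Finset.mem_range.mp hj))) ?_)
  rcases lt_or_eq_of_le hx.2 with h | h
  · refine ⟨0, by simp, ?_⟩
    have h0 := genBinom_pos hα (Nat.zero_le n)
    have h1 := Real.rpow_pos_of_pos (show 0 < 1 - x by linarith) (α * ((n : ℝ) - (0 : ℕ)))
    unfold fracBinomWeight
    simp only [Nat.cast_zero, mul_zero, Real.rpow_zero, mul_one] at h0 h1 ⊢
    exact mul_pos h0 h1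
  · refine ⟨n, by simp, ?_⟩
    have h0 := genBinom_pos hα (le_refl n)
    unfold fracBinomWeight
    simpa [h] using h0

/-- The fractional binomial distribution is a probability measure. -/
lemma isProbabilityMeasure_fracBinom {α x : ℝ} (hα : 0 < α) (hx : x ∈ Set.Icc (0 : ℝ) 1) (n : ℕ) :
    IsProbabilityMeasure (fracBinom α x n) := by
  have hZ := fracBinomZ_pos hα hx n
  constructor
  simp only [fracBinom, Measure.coe_finsetSum, Finset.sum_apply, Measure.smul_apply, measure_univ,
    smul_eq_mul, mul_one]
  rw [← ENNReal.ofReal_sum_of_nonneg, ← Finset.mul_sum]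
  · have h : α / fracBinomZ α x n * ∑ j ∈ Finset.range (n + 1), fracBinomWeight α x n j = 1 := by
      rw [div_mul_eq_mul_div]
      exact div_self hZ.ne'
    rw [h, ENNReal.ofReal_one]
  · intro j hj
    exact mul_nonneg (by positivity)
      (fracBinomWeight_nonneg hα hx (Nat.lt_succ_iff.mp (Finset.mem_range.mp hj)))

/-- The distribution function `Φ` of the standard normal distribution. -/
def stdNormalCDF (z : ℝ) : ℝ :=
  ∫ u in Set.Iic z, 1 / Real.sqrt (2 * Real.pi) * Real.exp (-u ^ 2 / 2)

end

/-! The rate follows from a local limit theorem for the weights with a Gaussian error term; no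
independence structure is used. Convexity of log Γ bounds the log-ratio of neighbouring weights by
differences of ordinary logarithms. With d = j - nx and β = α/(x(1-x)), this log-ratio is -βd/n up
to O(1/n + d²/n²) in the bulk, while a cruder linear drift of rate α holds out to the edges. Summing
from ⌊nx⌋ shows that w_j / w_⌊nx⌋ equals exp(-βd²/(2n)) up to O(n^(-1/2)) exp(-αd²/(4n)): this is
`abs_fracBinomWeight_div_sub_exp_le`.

On the grid t_j = dh of mesh h = √(β/n), the rescaled weights are therefore the Gaussian density up
to O(h) with Gaussian decay. Riemann sums then give the mass, the first two moments and all partial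
sums up to O(h). Only ratios of these sums enter, so the normalizing constant and the exact mean and
variance are never computed: `abs_div_sub_stdNormalCDF_le` absorbs their O(h) errors
(`exists_abs_sum_filter_div_sub_stdNormalCDF_le`). Finitely many small n go into the constant. -/

/-! ### Increments of log Γ. -/

/-- By convexity the slope of log Γ on [t, t+1], which is log t by the functional equation, is at
most its slope on [t+1, t+α+1]. The companion upper bound uses the unit interval to the right of
t+α+1 instead. -/
lemma le_log_Gamma_sub {α t : ℝ} (hα : 0 < α) (ht : 0 < t) :
    α * Real.log t ≤ Real.log (Real.Gamma (t + α + 1)) - Real.log (Real.Gamma (t + 1)) := by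
  have h := Real.convexOn_log_Gamma.slope_mono_adjacent (x := t) (y := t + 1) (z := t + α + 1)
    (Set.mem_Ioi.2 ht) (Set.mem_Ioi.2 (by linarith)) (by linarith) (by linarith)
  have h1 : Real.log (Real.Gamma (t + 1)) - Real.log (Real.Gamma t) = Real.log t := by
    rw [Real.Gamma_add_one ht.ne', Real.log_mul ht.ne' (Real.Gamma_pos_of_pos ht).ne']
    ring
  simp only [Function.comp_apply, h1] at h
  rw [show t + 1 - t = 1 by ring, show t + α + 1 - (t + 1) = α by ring, div_one,
    le_div_iff₀ hα] at h
  linarith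

lemma log_Gamma_sub_le {α t : ℝ} (hα : 0 < α) (ht : 0 ≤ t) :
    Real.log (Real.Gamma (t + α + 1)) - Real.log (Real.Gamma (t + 1))
      ≤ α * Real.log (t + α + 1) := by
  have ht' : 0 < t + α + 1 := by linarith
  have h := Real.convexOn_log_Gamma.slope_mono_adjacent (x := t + 1) (y := t + α + 1)
    (z := t + α + 1 + 1) (Set.mem_Ioi.2 (by linarith)) (Set.mem_Ioi.2 (by linarith))
    (by linarith) (by linarith)
  have h1 : Real.log (Real.Gamma (t + α + 1 + 1)) - Real.log (Real.Gamma (t + α + 1))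
      = Real.log (t + α + 1) := by
    rw [Real.Gamma_add_one ht'.ne', Real.log_mul ht'.ne' (Real.Gamma_pos_of_pos ht').ne']
    ring
  simp only [Function.comp_apply, h1] at h
  rw [show t + α + 1 + 1 - (t + α + 1) = 1 by ring, show t + α + 1 - (t + 1) = α by ring, div_one,
    div_le_iff₀ hα] at h
  linarith

/-! ### Ratios of consecutive weights. -/

lemma fracBinomWeight_pos {α x : ℝ} (hα : 0 < α) (hx : x ∈ Set.Ioo (0 : ℝ) 1) {n j : ℕ}
    (hj : j ≤ n) : 0 < fracBinomWeight α x n j :=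
  mul_pos (mul_pos (genBinom_pos hα hj) (Real.rpow_pos_of_pos hx.1 _))
    (Real.rpow_pos_of_pos (by linarith [hx.2]) _)

lemma log_fracBinomWeight {α x : ℝ} (hα : 0 < α) (hx : x ∈ Set.Ioo (0 : ℝ) 1) {n j : ℕ}
    (hj : j ≤ n) : Real.log (fracBinomWeight α x n j) =
      Real.log (Real.Gamma (α * n + 1)) - Real.log (Real.Gamma (α * j + 1))
        - Real.log (Real.Gamma (α * (n - j) + 1)) + α * j * Real.log x
        + α * (n - j) * Real.log (1 - x) := by
  have hjn : (j : ℝ) ≤ n := by exact_mod_cast hj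
  have h0 : 0 ≤ α * (n - j : ℝ) := mul_nonneg hα.le (by linarith)
  have h1 := Real.Gamma_pos_of_pos (show 0 < α * (n : ℝ) + 1 by positivity)
  have h2 := Real.Gamma_pos_of_pos (show 0 < α * (j : ℝ) + 1 by positivity)
  have h3 := Real.Gamma_pos_of_pos (show 0 < α * (n - j : ℝ) + 1 by linarith)
  have hx1 : 0 < 1 - x := by linarith [hx.2]
  have hr := Real.rpow_pos_of_pos hx.1 (α * (j : ℝ))
  have hr' := Real.rpow_pos_of_pos hx1 (α * (n - j : ℝ))
  unfold fracBinomWeight genBinom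
  rw [← mul_sub, Real.log_mul (by positivity) hr'.ne', Real.log_mul (by positivity) hr.ne',
    Real.log_div h1.ne' (by positivity), Real.log_mul h2.ne' h3.ne', Real.log_rpow hx.1,
    Real.log_rpow hx1]
  ring

/-- The logarithm of the ratio of consecutive weights, in terms of increments of `log Γ`. -/
lemma log_fracBinomWeight_succ_sub {α x : ℝ} (hα : 0 < α) (hx : x ∈ Set.Ioo (0 : ℝ) 1) {n j : ℕ}
    (hj : j < n) :
    Real.log (fracBinomWeight α x n (j + 1)) - Real.log (fracBinomWeight α x n j) =
      (Real.log (Real.Gamma (α * (n - j - 1) + α + 1)) - Real.log (Real.Gamma (α * (n - j - 1) + 1)))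
      - (Real.log (Real.Gamma (α * j + α + 1)) - Real.log (Real.Gamma (α * j + 1)))
      + α * Real.log x - α * Real.log (1 - x) := by
  rw [log_fracBinomWeight hα hx hj.le, log_fracBinomWeight hα hx hj]
  push_cast
  rw [show α * ((n : ℝ) - j - 1) + α + 1 = α * (n - j) + 1 by ring,
    show α * (j : ℝ) + α + 1 = α * (j + 1) + 1 by ring,
    show α * ((n : ℝ) - j - 1) + 1 = α * (n - (j + 1)) + 1 by ring]
  ring

lemma log_fracBinomWeight_succ_sub_le {α x : ℝ} (hα : 0 < α) (hx : x ∈ Set.Ioo (0 : ℝ) 1)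
    {n j : ℕ} (hj : j < n) (hj0 : 0 < j) :
    Real.log (fracBinomWeight α x n (j + 1)) - Real.log (fracBinomWeight α x n j) ≤
      α * (Real.log ((n - j + 1 / α) / (n * (1 - x))) - Real.log (j / (n * x))) := by
  have hx0 := hx.1
  have hx1 : 0 < 1 - x := by linarith [hx.2]
  have hn' : (0 : ℝ) < n := by exact_mod_cast (by omega : 0 < n)
  have hj' : (0 : ℝ) < j := by exact_mod_cast hj0
  have hjn : (j : ℝ) + 1 ≤ n := by exact_mod_cast hj
  have h1 := log_Gamma_sub_le hα (t := α * (n - j - 1)) (mul_nonneg hα.le (by linarith))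
  have h2 := le_log_Gamma_sub hα (t := α * j) (by positivity)
  have ha : 0 < (n : ℝ) - j + 1 / α := by
    have : 0 < 1 / α := by positivity
    linarith
  -- Factoring α out of both logarithms leaves a log α on each side; these cancel in the difference.
  rw [show α * ((n : ℝ) - j - 1) + α + 1 = α * (n - j + 1 / α) by field_simp; ring,
    Real.log_mul hα.ne' ha.ne'] at h1
  rw [Real.log_mul hα.ne' hj'.ne'] at h2
  rw [log_fracBinomWeight_succ_sub hα hx hj, Real.log_div ha.ne' (by positivity),
    Real.log_div hj'.ne' (by positivity), Real.log_mul hn'.ne' hx1.ne',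
    Real.log_mul hn'.ne' hx0.ne', show α * ((n : ℝ) - j - 1) + α + 1 = α * (n - j + 1 / α) by
    field_simp; ring]
  linarith

lemma le_log_fracBinomWeight_succ_sub {α x : ℝ} (hα : 0 < α) (hx : x ∈ Set.Ioo (0 : ℝ) 1)
    {n j : ℕ} (hj : j + 1 < n) :
    α * (Real.log ((n - j - 1) / (n * (1 - x))) - Real.log ((j + 1 + 1 / α) / (n * x))) ≤
    Real.log (fracBinomWeight α x n (j + 1)) - Real.log (fracBinomWeight α x n j) := by
  have hx0 := hx.1
  have hx1 : 0 < 1 - x := by linarith [hx.2]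
  have hn' : (0 : ℝ) < n := by exact_mod_cast (by omega : 0 < n)
  have hjn : 0 < (n : ℝ) - j - 1 := by
    have : (j : ℝ) + 1 < n := by exact_mod_cast hj
    linarith
  have h1 := le_log_Gamma_sub hα (t := α * (n - j - 1)) (by positivity)
  have h2 := log_Gamma_sub_le hα (t := α * j) (by positivity)
  have ha : 0 < (j : ℝ) + 1 + 1 / α := by positivity
  have he : α * (j : ℝ) + α + 1 = α * (j + 1 + 1 / α) := by field_simp
  rw [he, Real.log_mul hα.ne' ha.ne'] at h2
  rw [Real.log_mul hα.ne' hjn.ne'] at h1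
  rw [log_fracBinomWeight_succ_sub hα hx (by omega), Real.log_div ha.ne' (by positivity),
    Real.log_div hjn.ne' (by positivity), Real.log_mul hn'.ne' hx1.ne',
    Real.log_mul hn'.ne' hx0.ne', he]
  linarith

/-- From log(1+v) ≥ v/(1+v): multiplying out, the claim becomes v²(3+4v) ≥ 0, hence the threshold
-3/4. -/
lemma sub_four_mul_sq_le_log_one_add {v : ℝ} (hv : -(3 / 4) ≤ v) :
    v - 4 * v ^ 2 ≤ Real.log (1 + v) := by
  have h0 : 0 < 1 + v := by linarith
  refine le_trans ?_ (Real.one_sub_inv_le_log_of_pos h0)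
  have : 1 - (1 + v)⁻¹ = v / (1 + v) := by field_simp; ring
  rw [this, le_div_iff₀ h0]
  nlinarith [mul_nonneg (sq_nonneg v) (by linarith : 0 ≤ 3 + 4 * v)]

/-- Linearizing the two logarithms gives -d/(n(1-x)) - d/(nx) = -d/(n x(1-x)), the drift towards nx.
The size conditions keep the arguments of the logarithms away from 0, so that the quadratic lower
bound for log applies. -/
lemma abs_log_fracBinomWeight_succ_sub_add_le {α x : ℝ} (hα : 0 < α) (hx : x ∈ Set.Ioo (0 : ℝ) 1) :
    ∃ C : ℝ, 0 < C ∧ ∀ n j : ℕ, 4 ≤ n * x → 4 ≤ n * (1 - x) → j < n →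
      |(j : ℝ) - n * x| ≤ n * x / 2 → |(j : ℝ) - n * x| ≤ n * (1 - x) / 2 →
      |Real.log (fracBinomWeight α x n (j + 1)) - Real.log (fracBinomWeight α x n j)
        + α / (x * (1 - x)) * (j - n * x) / n| ≤ C * (1 / n + (j - n * x) ^ 2 / n ^ 2) := by
  have hx0 := hx.1
  have hx1 : 0 < 1 - x := by linarith [hx.2]
  refine ⟨α / (1 - x) + (α + 1) / x + 8 * α / (1 - x) ^ 2 + 4 * α / x ^ 2 + 1 / (1 - x),
    by positivity, ?_⟩
  intro n j hnx hny hj hd1 hd2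
  have hn : (0 : ℝ) < n := by exact_mod_cast (by omega : 0 < n)
  have hn1 : (1 : ℝ) ≤ n := by exact_mod_cast (by omega : 1 ≤ n)
  rw [abs_le] at hd1 hd2
  set d : ℝ := j - n * x with hd
  have hjd : (j : ℝ) = d + n * x := by rw [hd]; ring
  have hj0 : 0 < j := by
    have : (0 : ℝ) < j := by linarith
    exact_mod_cast this
  have hj1 : j + 1 < n := by
    have : (j : ℝ) + 1 < n := by linarith
    exact_mod_cast this
  have hr : 0 < 1 / (n : ℝ) := by positivity
  have hq : 0 ≤ d ^ 2 / (n : ℝ) ^ 2 := by positivity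
  have hup := log_fracBinomWeight_succ_sub_le hα hx hj hj0
  have hlo := le_log_fracBinomWeight_succ_sub hα hx hj1
  rw [abs_le]
  constructor
  · have h1 : -((d + 1) / (n * (1 - x))) - 4 * (-((d + 1) / (n * (1 - x)))) ^ 2
        ≤ Real.log ((n - j - 1) / (n * (1 - x))) := by
      have hv : -(3 / 4) ≤ -((d + 1) / (n * (1 - x))) := by
        rw [neg_le_neg_iff, div_le_iff₀ (by positivity)]
        linarith
      convert sub_four_mul_sq_le_log_one_add hv using 2
      rw [hjd]; field_simp; ring
    have h2 : Real.log ((j + 1 + 1 / α) / (n * x)) ≤ (d + 1 + 1 / α) / (n * x) := by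
      refine (Real.log_le_sub_one_of_pos (by positivity)).trans (le_of_eq ?_)
      rw [hjd]; field_simp; ring
    have h3 : α * (-((d + 1) / (n * (1 - x))) - 4 * (-((d + 1) / (n * (1 - x)))) ^ 2
        - (d + 1 + 1 / α) / (n * x)) + α / (x * (1 - x)) * d / n
        = - (α / (1 - x) * (1 / n) + (α + 1) / x * (1 / n)
          + 4 * α / (1 - x) ^ 2 * ((d + 1) ^ 2 / n ^ 2)) := by
      field_simp; ring
    have h4 : (d + 1) ^ 2 / (n : ℝ) ^ 2 ≤ 2 * (1 / n + d ^ 2 / n ^ 2) := by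
      rw [div_le_iff₀ (by positivity)]
      have : 2 * (1 / (n : ℝ) + d ^ 2 / n ^ 2) * n ^ 2 = 2 * (n + d ^ 2) := by field_simp
      rw [this]
      nlinarith [sq_nonneg (d - 1)]
    have h5 := mul_le_mul_of_nonneg_left (sub_le_sub h1 h2) hα.le
    have h6 := mul_le_mul_of_nonneg_left h4 (show 0 ≤ 4 * α / (1 - x) ^ 2 by positivity)
    have e1 : 0 ≤ α / (1 - x) * (d ^ 2 / n ^ 2) := by positivity
    have e2 : 0 ≤ (α + 1) / x * (d ^ 2 / n ^ 2) := by positivity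
    have e3 : 0 ≤ 4 * α / x ^ 2 * (1 / n + d ^ 2 / n ^ 2) := by positivity
    have e4 : 0 ≤ 1 / (1 - x) * (1 / n + d ^ 2 / n ^ 2) := by positivity
    have e5 : 8 * α / (1 - x) ^ 2 * (1 / n + d ^ 2 / n ^ 2)
      = 4 * α / (1 - x) ^ 2 * (2 * (1 / n + d ^ 2 / n ^ 2)) := by ring
    linarith
  · have h1 : d / (n * x) - 4 * (d / (n * x)) ^ 2 ≤ Real.log (j / (n * x)) := by
      have hv : -(3 / 4) ≤ d / (n * x) := by
        rw [le_div_iff₀ (by positivity)]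
        linarith
      convert sub_four_mul_sq_le_log_one_add hv using 2
      rw [hjd]; field_simp; ring
    have h2 : Real.log ((n - j + 1 / α) / (n * (1 - x))) ≤ (-d + 1 / α) / (n * (1 - x)) := by
      have hp : 0 < (n : ℝ) - j + 1 / α := by
        have : 0 < 1 / α := by positivity
        linarith
      refine (Real.log_le_sub_one_of_pos (by positivity)).trans (le_of_eq ?_)
      rw [hjd]; field_simp; ring
    have h3 : α * ((-d + 1 / α) / (n * (1 - x)) - (d / (n * x) - 4 * (d / (n * x)) ^ 2))
        + α / (x * (1 - x)) * d / n
        = 1 / (1 - x) * (1 / n) + 4 * α / x ^ 2 * (d ^ 2 / n ^ 2) := by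
      field_simp; ring
    have h5 := mul_le_mul_of_nonneg_left (sub_le_sub h2 h1) hα.le
    have e1 : 0 ≤ α / (1 - x) * (1 / n + d ^ 2 / n ^ 2) := by positivity
    have e2 : 0 ≤ (α + 1) / x * (1 / n + d ^ 2 / n ^ 2) := by positivity
    have e3 : 0 ≤ 4 * α / x ^ 2 * (1 / n) := by positivity
    have e4 : 0 ≤ 1 / (1 - x) * (d ^ 2 / n ^ 2) := by positivity
    have e5 : 0 ≤ 8 * α / (1 - x) ^ 2 * (1 / n + d ^ 2 / n ^ 2) := by positivity
    linarith

/-- Only one logarithm supplies drift here: log(j/(nx)) ≥ d/j, and j ≤ n turns this into d/n up to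
O(1/n). The other is merely bounded by O(1/n). The rate drops from α/(x(1-x)) to α, but the bound
reaches the right edge. Allowing d ≥ -1 admits the starting index ⌊nx⌋. -/
lemma log_fracBinomWeight_succ_sub_le_of_ge {α x : ℝ} (hα : 0 < α) (hx : x ∈ Set.Ioo (0 : ℝ) 1) :
    ∃ C : ℝ, 0 < C ∧ ∀ n j : ℕ, 4 ≤ n * x → j < n → -1 ≤ (j : ℝ) - n * x →
      Real.log (fracBinomWeight α x n (j + 1)) - Real.log (fracBinomWeight α x n j)
        ≤ -(α * (j - n * x) / n) + C / n := by
  have hx0 := hx.1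
  have hx1 : 0 < 1 - x := by linarith [hx.2]
  refine ⟨(α + 1) / (1 - x) + 2 * α / x, by positivity, ?_⟩
  intro n j hnx hj hdl
  have hn : (0 : ℝ) < n := by exact_mod_cast (by omega : 0 < n)
  have hjn : (j : ℝ) ≤ n := by exact_mod_cast hj.le
  set d : ℝ := j - n * x with hd
  have hjd : (j : ℝ) = d + n * x := by rw [hd]; ring
  have hjpos : (0 : ℝ) < j := by linarith
  have hup := log_fracBinomWeight_succ_sub_le hα hx hj (by exact_mod_cast hjpos)
  have h1 : d / n - 2 / (n * x) ≤ Real.log (j / (n * x)) := by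
    refine le_trans ?_ (Real.one_sub_inv_le_log_of_pos (by positivity))
    have e : 1 - (j / (n * x))⁻¹ = d / j := by rw [hjd] at hjpos ⊢; field_simp; ring
    have e1 : d / n - 2 / (n * x) = (d * x - 2) / (n * x) := by field_simp
    rw [e, e1, div_le_div_iff₀ (by positivity) hjpos]
    rcases le_or_gt 0 d with h | h
    · nlinarith [mul_le_mul_of_nonneg_left hjn (mul_nonneg h hx0.le)]
    · nlinarith [mul_nonneg (neg_nonneg.2 h.le) (mul_nonneg hx0.le hjpos.le),
        mul_nonneg (by linarith : 0 ≤ d + 1) (mul_nonneg hx0.le hn.le)]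
  have h2 : Real.log ((n - j + 1 / α) / (n * (1 - x))) ≤ (1 + 1 / α) / (n * (1 - x)) := by
    have hp : 0 < (n : ℝ) - j + 1 / α := by
      have : 0 < 1 / α := by positivity
      linarith
    refine (Real.log_le_sub_one_of_pos (by positivity)).trans ?_
    have e : (n - j + 1 / α) / (n * (1 - x)) - 1 = (-d + 1 / α) / (n * (1 - x)) := by
      rw [hjd]; field_simp; ring
    rw [e]
    gcongr
    linarith
  have h5 := mul_le_mul_of_nonneg_left (sub_le_sub h2 h1) hα.le
  have h3 : α * ((1 + 1 / α) / (n * (1 - x)) - (d / n - 2 / (n * x))) =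
      -(α * d / n) + ((α + 1) / (1 - x) + 2 * α / x) / n := by
    field_simp; ring
  linarith

/-- Mirror image for the left side, with the drift now coming from the factor n - j - 1. The
condition on j covers every step ending at or before ⌊nx⌋. -/
lemma le_log_fracBinomWeight_succ_sub_of_le {α x : ℝ} (hα : 0 < α) (hx : x ∈ Set.Ioo (0 : ℝ) 1) :
    ∃ C : ℝ, 0 < C ∧ ∀ n j : ℕ, (j : ℝ) + 1 ≤ n * x →
      -(α * (j - n * x) / n) - C / n ≤
      Real.log (fracBinomWeight α x n (j + 1)) - Real.log (fracBinomWeight α x n j) := by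
  have hx0 := hx.1
  have hx1 : 0 < 1 - x := by linarith [hx.2]
  refine ⟨(α + 1) / x + α / (1 - x), by positivity, ?_⟩
  intro n j hjx
  have hn : (0 : ℝ) < n := by
    by_contra h
    have h0 : (n : ℝ) = 0 := le_antisymm (not_lt.1 h) (by positivity)
    rw [h0] at hjx
    have : (0 : ℝ) ≤ j := by positivity
    linarith
  set d : ℝ := j - n * x with hd
  have hjd : (j : ℝ) = d + n * x := by rw [hd]; ring
  have hjpos : (0 : ℝ) ≤ j := by positivity
  have hny : 0 < n * (1 - x) := by positivity
  have hj1 : j + 1 < n := by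
    have : (j : ℝ) + 1 < n := by linarith
    exact_mod_cast this
  have hm : 0 < (n : ℝ) - j - 1 := by linarith
  have hlo := le_log_fracBinomWeight_succ_sub hα hx hj1
  have h1 : -(d / n) - 1 / (n * (1 - x)) ≤ Real.log ((n - j - 1) / (n * (1 - x))) := by
    refine le_trans ?_ (Real.one_sub_inv_le_log_of_pos (by positivity))
    have e : 1 - ((n - j - 1) / (n * (1 - x)))⁻¹ = (-d - 1) / (n - j - 1) := by
      rw [hjd] at hm ⊢; field_simp; ring
    have e1 : -(d / n) - 1 / (n * (1 - x)) = -d / n - 1 / (n * (1 - x)) := by ring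
    rw [e, e1, sub_div]
    refine sub_le_sub ?_ ?_
    · exact div_le_div_of_nonneg_left (by linarith) hm (by linarith)
    · exact div_le_div_of_nonneg_left zero_le_one hny (by linarith)
  have h2 : Real.log ((j + 1 + 1 / α) / (n * x)) ≤ (1 + 1 / α) / (n * x) := by
    refine (Real.log_le_sub_one_of_pos (by positivity)).trans ?_
    have e : (j + 1 + 1 / α) / (n * x) - 1 = (d + 1 + 1 / α) / (n * x) := by
      rw [hjd]; field_simp; ring
    rw [e]
    gcongr
    linarith
  have h5 := mul_le_mul_of_nonneg_left (sub_le_sub h1 h2) hα.le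
  have h3 : α * (-(d / n) - 1 / (n * (1 - x)) - (1 + 1 / α) / (n * x)) =
      -(α * d / n) - ((α + 1) / x + α / (1 - x)) / n := by
    field_simp; ring
  linarith

/-! ### Telescoping and elementary bounds for the exponential. -/

lemma sub_le_mul_sub_of_succ_sub_le {f : ℕ → ℝ} {M : ℝ} {k j : ℕ} (hkj : k ≤ j)
    (h : ∀ i, k ≤ i → i < j → f (i + 1) - f i ≤ M) : f j - f k ≤ M * (j - k) := by
  induction j, hkj using Nat.le_induction with
  | base => simp
  | succ m hm ih =>
    have h1 := ih fun i hi him => h i hi (by omega)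
    have h2 := h m hm (by omega)
    push_cast
    linarith

lemma abs_sub_le_mul_abs_sub_of_abs_succ_sub_le {f : ℕ → ℝ} {M : ℝ} {k j : ℕ}
    (h : ∀ i, min k j ≤ i → i < max k j → |f (i + 1) - f i| ≤ M) :
    |f j - f k| ≤ M * |(j : ℝ) - k| := by
  wlog hkj : k ≤ j generalizing k j
  · rw [abs_sub_comm, abs_sub_comm (j : ℝ)]
    exact this (fun i h1 h2 => h i (by rwa [min_comm]) (by rwa [max_comm])) (by omega)
  rw [min_eq_left hkj, max_eq_right hkj] at h
  have h0 : (k : ℝ) ≤ j := by exact_mod_cast hkj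
  rw [abs_of_nonneg (sub_nonneg.2 h0), abs_le]
  have h1 := sub_le_mul_sub_of_succ_sub_le hkj fun i hi hij => (abs_le.1 (h i hi hij)).2
  have h2 := sub_le_mul_sub_of_succ_sub_le (f := fun i => -f i) hkj fun i hi hij => by
    linarith [(abs_le.1 (h i hi hij)).1]
  constructor <;> linarith

lemma abs_exp_sub_exp_le {a b M : ℝ} (ha : a ≤ M) (hb : b ≤ M) :
    |Real.exp a - Real.exp b| ≤ |a - b| * Real.exp M := by
  wlog hab : b ≤ a generalizing a b
  · rw [abs_sub_comm, abs_sub_comm a]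
    exact this hb ha (le_of_not_ge hab)
  rw [abs_of_nonneg (sub_nonneg.2 (Real.exp_le_exp.2 hab)), abs_of_nonneg (sub_nonneg.2 hab)]
  have h1 : Real.exp b = Real.exp a * Real.exp (b - a) := by rw [← Real.exp_add]; ring_nf
  have h2 := Real.add_one_le_exp (b - a)
  have h3 : Real.exp a ≤ Real.exp M := Real.exp_le_exp.2 ha
  calc Real.exp a - Real.exp b = Real.exp a * (1 - Real.exp (b - a)) := by rw [h1]; ring
    _ ≤ Real.exp a * (a - b) := mul_le_mul_of_nonneg_left (by linarith) (Real.exp_pos a).le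
    _ ≤ (a - b) * Real.exp M := by
      rw [mul_comm]
      exact mul_le_mul_of_nonneg_left h3 (sub_nonneg.2 hab)

lemma exists_one_add_abs_pow_le_mul_exp (k : ℕ) {c : ℝ} (hc : 0 < c) :
    ∃ A : ℝ, 0 < A ∧ ∀ v : ℝ, (1 + |v|) ^ k ≤ A * Real.exp (c * v ^ 2) := by
  -- The k-th power of exp(b v²) must stay below exp(c v²), so kb ≤ c; the k + 1 avoids division by
  -- zero.
  set b := c / (k + 1) with hb
  have hb0 : 0 < b := by positivity
  refine ⟨(2 + 1 / b) ^ k, by positivity, fun v => ?_⟩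
  have h1 : 1 + |v| ≤ (2 + 1 / b) * Real.exp (b * v ^ 2) := by
    have h2 := Real.add_one_le_exp (b * v ^ 2)
    have h3 : |v| ≤ 1 + v ^ 2 := by
      rw [← sq_abs]; nlinarith [sq_nonneg (|v| - 1), abs_nonneg v]
    calc 1 + |v| ≤ 2 + v ^ 2 := by linarith
      _ ≤ (2 + 1 / b) * (b * v ^ 2 + 1) := by
        have : (2 + 1 / b) * (b * v ^ 2 + 1) = 2 + v ^ 2 + (2 * b * v ^ 2 + 1 / b) := by
          field_simp; ring
        rw [this]
        have : 0 ≤ 2 * b * v ^ 2 + 1 / b := by positivity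
        linarith
      _ ≤ _ := by gcongr
  calc (1 + |v|) ^ k ≤ ((2 + 1 / b) * Real.exp (b * v ^ 2)) ^ k := by gcongr
    _ = (2 + 1 / b) ^ k * Real.exp (k * (b * v ^ 2)) := by rw [mul_pow, ← Real.exp_nat_mul]
    _ ≤ _ := by
      refine mul_le_mul_of_nonneg_left (Real.exp_le_exp.2 ?_) (by positivity)
      rw [← mul_assoc]
      refine mul_le_mul_of_nonneg_right ?_ (sq_nonneg v)
      rw [hb, mul_div_assoc', div_le_iff₀ (by positivity)]
      nlinarith

/-! ### Gaussian approximation of the weights. -/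

/-- Gaussian upper bound, uniform in the whole range, for the weights relative to the weight at
`⌊n x⌋`. -/
lemma log_fracBinomWeight_sub_le {α x : ℝ} (hα : 0 < α) (hx : x ∈ Set.Ioo (0 : ℝ) 1) :
    ∃ C : ℝ, 0 < C ∧ ∀ n j : ℕ, 4 ≤ n * x → j ≤ n →
      Real.log (fracBinomWeight α x n j) - Real.log (fracBinomWeight α x n ⌊n * x⌋₊)
        ≤ C - α * (j - n * x) ^ 2 / (2 * n) := by
  obtain ⟨C, hC, hup⟩ := log_fracBinomWeight_succ_sub_le_of_ge hα hx
  obtain ⟨C', hC', hlo⟩ := le_log_fracBinomWeight_succ_sub_of_le hα hx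
  refine ⟨C + C' + 2 * α, by positivity, fun n j hnx hj => ?_⟩
  have hx0 := hx.1
  have hn : (0 : ℝ) < n := by
    by_contra h
    have h0 : (n : ℝ) = 0 := le_antisymm (not_lt.1 h) (by positivity)
    rw [h0] at hnx
    linarith
  have hn1 : (1 : ℝ) ≤ n := by exact_mod_cast hn
  set k := ⌊n * x⌋₊ with hk
  have hk1 : (k : ℝ) ≤ n * x := Nat.floor_le (by positivity)
  have hk2 : n * x < k + 1 := Nat.lt_floor_add_one _
  -- The added quadratic cancels the drift: increments of U away from ⌊nx⌋ are at most O(1/n), and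
  -- at most n of them are summed.
  set U : ℕ → ℝ := fun i => Real.log (fracBinomWeight α x n i) + α * (i - n * x) ^ 2 / (2 * n)
    with hU
  have hUs : ∀ i, U (i + 1) - U i = Real.log (fracBinomWeight α x n (i + 1))
      - Real.log (fracBinomWeight α x n i) + α * (i - n * x) / n + α / (2 * n) := by
    intro i
    simp only [hU]
    push_cast
    field_simp
    ring
  have hαn : α / (2 * n) ≤ α / n := by gcongr; linarith
  have hαn0 : 0 < α / (2 * n) := by positivity
  have hUk : α * (k - n * x) ^ 2 / (2 * n) ≤ α := by
    rw [div_le_iff₀ (by positivity)]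
    have : ((k : ℝ) - n * x) ^ 2 ≤ 1 := by nlinarith
    nlinarith
  have key : U j - U k ≤ C + C' + α := by
    rcases le_total k j with h | h
    · have h1 := sub_le_mul_sub_of_succ_sub_le (f := U) (M := (C + α) / n) h fun i hi hij => by
        have hik : (k : ℝ) ≤ i := by exact_mod_cast hi
        have := hup n i hnx (by omega) (by linarith)
        rw [hUs, add_div]
        linarith
      have h2 : (C + α) / n * ((j : ℝ) - k) ≤ (C + α) / n * n := by
        gcongr
        have : (j : ℝ) ≤ n := by exact_mod_cast hj
        have : (0 : ℝ) ≤ k := by positivity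
        linarith
      rw [div_mul_cancel₀ _ hn.ne'] at h2
      linarith
    · have h1 := sub_le_mul_sub_of_succ_sub_le (f := fun i => -U i) (M := C' / n) h
        fun i hi hij => by
        have hik : (i : ℝ) + 1 ≤ k := by exact_mod_cast hij
        have h3 := hlo n i (by linarith)
        have h4 := hUs i
        linarith
      have h2 : C' / n * ((k : ℝ) - j) ≤ C' / n * n := by
        gcongr
        have : (0 : ℝ) ≤ j := by positivity
        have := hx.2
        nlinarith
      rw [div_mul_cancel₀ _ hn.ne'] at h2
      linarith
  simp only [hU] at key
  linarith

/-- Second order expansion of the log-weights around `n x`, in the bulk. -/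
lemma abs_log_fracBinomWeight_sub_add_le {α x : ℝ} (hα : 0 < α) (hx : x ∈ Set.Ioo (0 : ℝ) 1) :
    ∃ C : ℝ, 0 < C ∧ ∀ n j : ℕ, 4 ≤ n * x → 4 ≤ n * (1 - x) → j ≤ n →
      |(j : ℝ) - n * x| + 1 ≤ n * x / 2 → |(j : ℝ) - n * x| + 1 ≤ n * (1 - x) / 2 →
      |Real.log (fracBinomWeight α x n j) - Real.log (fracBinomWeight α x n ⌊n * x⌋₊)
        + α / (x * (1 - x)) * (j - n * x) ^ 2 / (2 * n)|
        ≤ C * ((|(j : ℝ) - n * x| + 1) / n + (|(j : ℝ) - n * x| + 1) ^ 3 / n ^ 2) := by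
  obtain ⟨C, hC, hinc⟩ := abs_log_fracBinomWeight_succ_sub_add_le hα hx
  have hx0 := hx.1
  have hx1 : 0 < 1 - x := by linarith [hx.2]
  set β := α / (x * (1 - x)) with hβ
  have hβ0 : 0 < β := by positivity
  refine ⟨C + 2 * β, by positivity, fun n j hnx hny hj hD1 hD2 => ?_⟩
  have hn : (0 : ℝ) < n := by
    by_contra h
    have h0 : (n : ℝ) = 0 := le_antisymm (not_lt.1 h) (by positivity)
    rw [h0] at hnx
    linarith
  set k := ⌊n * x⌋₊ with hk
  have hk1 : (k : ℝ) ≤ n * x := Nat.floor_le (by positivity)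
  have hk2 : n * x < k + 1 := Nat.lt_floor_add_one _
  have hkn : k ≤ n := by
    have : (k : ℝ) ≤ n := by nlinarith
    exact_mod_cast this
  set D : ℝ := |(j : ℝ) - n * x| + 1 with hD
  have hDle : (j : ℝ) - n * x ≤ D - 1 := by rw [hD]; linarith [le_abs_self ((j : ℝ) - n * x)]
  have hDge : -(D - 1) ≤ (j : ℝ) - n * x := by rw [hD]; linarith [neg_abs_le ((j : ℝ) - n * x)]
  have hD0 : 1 ≤ D := by rw [hD]; linarith [abs_nonneg ((j : ℝ) - n * x)]
  -- Same device with the exact coefficient β, so that the increments are now small in absolute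
  -- value.
  set E : ℕ → ℝ := fun i => Real.log (fracBinomWeight α x n i) + β * (i - n * x) ^ 2 / (2 * n)
    with hE
  have hEs : ∀ i, E (i + 1) - E i = Real.log (fracBinomWeight α x n (i + 1))
      - Real.log (fracBinomWeight α x n i) + β * (i - n * x) / n + β / (2 * n) := by
    intro i
    simp only [hE]
    push_cast
    field_simp
    ring
  have hβn : β / (2 * n) ≤ β * (1 / n) := by
    rw [mul_one_div]; gcongr; linarith
  have hstep : |E j - E k| ≤ (C + β) * (1 / n + D ^ 2 / n ^ 2) * |(j : ℝ) - k| := by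
    refine abs_sub_le_mul_abs_sub_of_abs_succ_sub_le fun i hi1 hi2 => ?_
    have hid : |(i : ℝ) - n * x| ≤ D := by
      rw [abs_le]
      constructor
      · rcases min_le_iff.1 hi1 with h | h
        · have : (k : ℝ) ≤ i := by exact_mod_cast h
          linarith
        · have : (j : ℝ) ≤ i := by exact_mod_cast h
          linarith
      · rcases lt_max_iff.1 hi2 with h | h
        · have : (i : ℝ) < k := by exact_mod_cast h
          linarith
        · have : (i : ℝ) < j := by exact_mod_cast h
          linarith
    have h1 := hinc n i hnx hny (by omega) (hid.trans hD1) (hid.trans hD2)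
    have h2 : C * (1 / n + ((i : ℝ) - n * x) ^ 2 / n ^ 2) ≤ C * (1 / n + D ^ 2 / n ^ 2) := by
      have : ((i : ℝ) - n * x) ^ 2 ≤ D ^ 2 := by
        rw [← sq_abs ((i : ℝ) - n * x)]; gcongr
      gcongr
    have h3 : 0 ≤ β * (D ^ 2 / n ^ 2) := by positivity
    have h4 : 0 < β / (2 * n) := by positivity
    rw [hEs]
    refine (abs_add_le _ _).trans ?_
    rw [abs_of_pos h4]
    linarith
  have hjk : |(j : ℝ) - k| ≤ D := by
    rw [abs_le]
    constructor <;> linarith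
  have hEk : |β * (k - n * x) ^ 2 / (2 * n)| ≤ β * (D / n) := by
    rw [abs_of_nonneg (by positivity), mul_div_assoc]
    gcongr β * ?_
    have : ((k : ℝ) - n * x) ^ 2 ≤ 1 := by nlinarith
    rw [div_le_div_iff₀ (by positivity) hn]
    nlinarith
  have h5 : (C + β) * (1 / n + D ^ 2 / n ^ 2) * |(j : ℝ) - k|
      ≤ (C + β) * (1 / n + D ^ 2 / n ^ 2) * D := by gcongr
  have h6 : (C + β) * (1 / n + D ^ 2 / n ^ 2) * D = (C + β) * (D / n + D ^ 3 / n ^ 2) := by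
    ring
  have h7 : 0 ≤ β * (D ^ 3 / n ^ 2) := by positivity
  have h8 : Real.log (fracBinomWeight α x n j) - Real.log (fracBinomWeight α x n k)
      + β * (j - n * x) ^ 2 / (2 * n) = (E j - E k) + β * (k - n * x) ^ 2 / (2 * n) := by
    simp only [hE]; ring
  rw [h8]
  refine (abs_add_le _ _).trans ?_
  linarith

/-- Used with s = √n, D = |d| + 1 and v = d/s. In the bulk the exponents differ by O((1+|v|)³/s).
Outside it, D > δs² already forces (1+|v|)³/s to be at least δ, so the trivial bound 2 exp M has the
same form. -/
lemma abs_exp_sub_exp_le_of_bulk {a b M C δ s v D : ℝ} (hC : 0 ≤ C) (hδ : 0 < δ) (hs : 0 < s)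
    (hD : 0 < D) (hDv : D / s ≤ 1 + |v|) (ha : a ≤ M) (hb : b ≤ M)
    (h : D ≤ δ * s ^ 2 → |a - b| ≤ C * (D / s ^ 2 + D ^ 3 / (s ^ 2) ^ 2)) :
    |Real.exp a - Real.exp b| ≤ (2 * C + 2 / δ) * ((1 + |v|) ^ 3 / s) * Real.exp M := by
  have hv0 : 1 ≤ 1 + |v| := by linarith [abs_nonneg v]
  have hcube : 1 + |v| ≤ (1 + |v|) ^ 3 := le_self_pow₀ hv0 (by norm_num)
  have hM := (Real.exp_pos M).le
  set Y := (1 + |v|) ^ 3 with hY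
  have hY0 : 0 ≤ Y := by linarith
  by_cases hDδ : D ≤ δ * s ^ 2
  · have h4 : D / s ^ 2 + D ^ 3 / (s ^ 2) ^ 2 ≤ 2 * (Y / s) := by
      have e : D / s ^ 2 + D ^ 3 / (s ^ 2) ^ 2 = (D / s + (D / s) ^ 3) / s := by field_simp
      have : (D / s) ^ 3 ≤ Y := pow_le_pow_left₀ (by positivity) hDv 3
      rw [e, ← mul_div_assoc]
      exact div_le_div_of_nonneg_right (by linarith) hs.le
    have h5 : |a - b| ≤ C * (2 * (Y / s)) := (h hDδ).trans (mul_le_mul_of_nonneg_left h4 hC)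
    have h8 : 0 ≤ 2 / δ * (Y / s) * Real.exp M := by positivity
    have h9 := mul_le_mul_of_nonneg_right h5 hM
    linarith [abs_exp_sub_exp_le ha hb]
  · have h6 : 1 ≤ 1 / δ * (Y / s) := by
      have h61 : 1 ≤ D / (δ * s ^ 2) := by
        rw [le_div_iff₀ (by positivity)]; linarith
      have e : D / (δ * s ^ 2) = 1 / δ * (D / s / s) := by field_simp
      rw [e] at h61
      exact h61.trans (mul_le_mul_of_nonneg_left
        (div_le_div_of_nonneg_right (hDv.trans hcube) hs.le) (by positivity))
    have h7 : |Real.exp a - Real.exp b| ≤ 2 * Real.exp M := by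
      have e1 := Real.exp_le_exp.2 ha
      have e2 := Real.exp_le_exp.2 hb
      rw [abs_le]
      constructor <;> linarith [Real.exp_pos a, Real.exp_pos b]
    have h8 : 0 ≤ 2 * C * (Y / s) * Real.exp M := by positivity
    have h9 := mul_le_mul_of_nonneg_right h6 hM
    have h10 : 2 / δ * (Y / s) * Real.exp M = 2 * (1 / δ * (Y / s) * Real.exp M) := by ring
    linarith

/-- Local limit estimate with Gaussian error weight for the fractional binomial weights. -/
lemma abs_fracBinomWeight_div_sub_exp_le {α x : ℝ} (hα : 0 < α) (hx : x ∈ Set.Ioo (0 : ℝ) 1) :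
    ∃ K : ℝ, 0 < K ∧ ∀ n j : ℕ, 4 ≤ n * x → 4 ≤ n * (1 - x) → j ≤ n →
      |fracBinomWeight α x n j / fracBinomWeight α x n ⌊n * x⌋₊
        - Real.exp (-(α / (x * (1 - x)) * (j - n * x) ^ 2 / (2 * n)))|
        ≤ K / Real.sqrt n * Real.exp (-(α / 4 * ((j - n * x) ^ 2 / n))) := by
  obtain ⟨C₁, hC₁, hup⟩ := log_fracBinomWeight_sub_le hα hx
  obtain ⟨C₂, hC₂, hexp⟩ := abs_log_fracBinomWeight_sub_add_le hα hx
  obtain ⟨A, hA, hpoly⟩ := exists_one_add_abs_pow_le_mul_exp 3 (c := α / 4) (by positivity)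
  have hx0 := hx.1
  have hx1 : 0 < 1 - x := by linarith [hx.2]
  set β := α / (x * (1 - x)) with hβ
  have hβ0 : 0 < β := by positivity
  -- Lets the single exponent M, with the weaker rate α, dominate both a and b.
  have hαβ : α ≤ β := by
    rw [hβ, le_div_iff₀ (by positivity)]
    have : x * (1 - x) ≤ 1 := by nlinarith
    nlinarith
  set δ := min x (1 - x) / 2 with hδ
  have hδ0 : 0 < δ := by have := lt_min hx0 hx1; positivity
  refine ⟨(2 * C₂ + 2 / δ) * Real.exp C₁ * A, by positivity, fun n j hnx hny hj => ?_⟩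
  have hn : (0 : ℝ) < n := by
    by_contra h
    have h0 : (n : ℝ) = 0 := le_antisymm (not_lt.1 h) (by positivity)
    rw [h0] at hnx
    linarith
  have hn1 : (1 : ℝ) ≤ n := by exact_mod_cast hn
  have hkn : ⌊n * x⌋₊ ≤ n := by
    have : (⌊n * x⌋₊ : ℝ) ≤ n := (Nat.floor_le (by positivity)).trans (by nlinarith)
    exact_mod_cast this
  have hwj := fracBinomWeight_pos hα hx hj
  have hwk := fracBinomWeight_pos hα hx hkn
  have h1 := hup n j hnx hj
  have h2 := hexp n j hnx hny hj
  set a := Real.log (fracBinomWeight α x n j) - Real.log (fracBinomWeight α x n ⌊n * x⌋₊) with ha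
  set b := -(β * (j - n * x) ^ 2 / (2 * n)) with hb
  have hea : fracBinomWeight α x n j / fracBinomWeight α x n ⌊n * x⌋₊ = Real.exp a := by
    rw [ha, Real.exp_sub, Real.exp_log hwj, Real.exp_log hwk]
  rw [hea]
  set s := Real.sqrt n with hs
  have hs1 : 1 ≤ s := Real.one_le_sqrt.2 hn1
  have hs0 : 0 < s := by linarith
  have hss : (n : ℝ) = s ^ 2 := (Real.sq_sqrt hn.le).symm
  set v := ((j : ℝ) - n * x) / s with hv
  have hv2 : ((j : ℝ) - n * x) ^ 2 / n = v ^ 2 := by rw [hv, hss, div_pow]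
  set M := C₁ - α / 2 * v ^ 2 with hM
  have haM : a ≤ M := by
    have : α * ((j : ℝ) - n * x) ^ 2 / (2 * n) = α / 2 * v ^ 2 := by rw [← hv2]; field_simp
    rw [hM]; linarith
  have hbM : b ≤ M := by
    have : β * ((j : ℝ) - n * x) ^ 2 / (2 * n) = β / 2 * v ^ 2 := by rw [← hv2]; field_simp
    rw [hM, hb, this]
    nlinarith [mul_le_mul_of_nonneg_right hαβ (sq_nonneg v)]
  set D := |(j : ℝ) - n * x| + 1 with hD
  have hDpos : 0 < D := by positivity
  have hy : D / s ≤ 1 + |v| := by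
    rw [hD, add_div, hv, abs_div, abs_of_pos hs0, add_comm]
    gcongr
    exact (div_le_one hs0).2 hs1
  have hv0 : 1 ≤ 1 + |v| := by linarith [abs_nonneg v]
  have main : |Real.exp a - Real.exp b|
      ≤ (2 * C₂ + 2 / δ) * ((1 + |v|) ^ 3 / s) * Real.exp M := by
    refine abs_exp_sub_exp_le_of_bulk hC₂.le hδ0 hs0 hDpos hy haM hbM fun hDδ => ?_
    have e1 : δ ≤ x / 2 := by
      have := min_le_left x (1 - x)
      rw [hδ]; linarith
    have e2 : δ ≤ (1 - x) / 2 := by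
      have := min_le_right x (1 - x)
      rw [hδ]; linarith
    rw [← hss] at hDδ ⊢
    have h3 := h2 (by nlinarith) (by nlinarith)
    rw [hb, sub_neg_eq_add]
    exact h3
  refine main.trans ?_
  -- One half of the Gaussian factor absorbs the cubic polynomial; the other half is kept as decay.
  have hMe : Real.exp M = Real.exp C₁ * (Real.exp (-(α / 4 * v ^ 2)) * Real.exp (-(α / 4 * v ^ 2)))
      := by
    rw [← Real.exp_add, ← Real.exp_add, hM]; ring_nf
  have hAe : (1 + |v|) ^ 3 * Real.exp (-(α / 4 * v ^ 2)) ≤ A := by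
    rw [Real.exp_neg, ← div_eq_mul_inv, div_le_iff₀ (Real.exp_pos _)]
    exact hpoly v
  rw [hv2, hMe]
  calc (2 * C₂ + 2 / δ) * ((1 + |v|) ^ 3 / s) *
        (Real.exp C₁ * (Real.exp (-(α / 4 * v ^ 2)) * Real.exp (-(α / 4 * v ^ 2))))
      = (2 * C₂ + 2 / δ) * Real.exp C₁ * ((1 + |v|) ^ 3 * Real.exp (-(α / 4 * v ^ 2))) / s
        * Real.exp (-(α / 4 * v ^ 2)) := by ring
    _ ≤ _ := by gcongr

/-! ### The standard normal density: moments, tails and local variation. -/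

lemma gaussianPDFReal_zero_one (u : ℝ) :
    gaussianPDFReal 0 1 u = (Real.sqrt (2 * Real.pi))⁻¹ * Real.exp (-u ^ 2 / 2) := by
  simp [gaussianPDFReal_def]

lemma inv_sqrt_two_pi_le_one : (Real.sqrt (2 * Real.pi))⁻¹ ≤ 1 := by
  refine inv_le_one_of_one_le₀ (Real.one_le_sqrt.2 ?_)
  linarith [Real.pi_gt_three]

lemma gaussianPDFReal_zero_one_le_exp (u : ℝ) :
    gaussianPDFReal 0 1 u ≤ Real.exp (-u ^ 2 / 2) := by
  rw [gaussianPDFReal_zero_one]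
  exact mul_le_of_le_one_left (Real.exp_pos _).le inv_sqrt_two_pi_le_one

lemma gaussianPDFReal_zero_one_le_one (u : ℝ) : gaussianPDFReal 0 1 u ≤ 1 :=
  (gaussianPDFReal_zero_one_le_exp u).trans (Real.exp_le_one_iff.2 (by nlinarith [sq_nonneg u]))

lemma hasDerivAt_gaussianPDFReal_zero_one (u : ℝ) :
    HasDerivAt (gaussianPDFReal 0 1) (-u * gaussianPDFReal 0 1 u) u := by
  have h : HasDerivAt (fun u : ℝ => (Real.sqrt (2 * Real.pi))⁻¹ * Real.exp (-u ^ 2 / 2))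
      ((Real.sqrt (2 * Real.pi))⁻¹ * (Real.exp (-u ^ 2 / 2) * (-(2 * u) / 2))) u := by
    have := ((hasDerivAt_pow 2 u).neg.div_const 2).exp.const_mul (Real.sqrt (2 * Real.pi))⁻¹
    simpa using this
  have he : gaussianPDFReal 0 1 = fun u => (Real.sqrt (2 * Real.pi))⁻¹ * Real.exp (-u ^ 2 / 2) :=
    funext gaussianPDFReal_zero_one
  rw [he]
  convert h using 1
  ring

lemma continuous_pow_mul_gaussianPDFReal (k : ℕ) :
    Continuous fun u : ℝ => u ^ k * gaussianPDFReal 0 1 u :=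
  (continuous_pow k).mul
    (continuous_iff_continuousAt.2 fun u => (hasDerivAt_gaussianPDFReal_zero_one u).continuousAt)

lemma exists_one_add_abs_pow_mul_gaussianPDFReal_le (k : ℕ) :
    ∃ A : ℝ, 0 < A ∧ ∀ u : ℝ,
      (1 + |u|) ^ k * gaussianPDFReal 0 1 u ≤ A * Real.exp (-(1 / 4 * u ^ 2)) := by
  obtain ⟨A, hA, h⟩ := exists_one_add_abs_pow_le_mul_exp k (c := 1 / 4) (by norm_num)
  refine ⟨A, hA, fun u => ?_⟩
  calc (1 + |u|) ^ k * gaussianPDFReal 0 1 u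
      ≤ (A * Real.exp (1 / 4 * u ^ 2)) * Real.exp (-u ^ 2 / 2) :=
        mul_le_mul (h u) (gaussianPDFReal_zero_one_le_exp u) (gaussianPDFReal_nonneg _ _ _)
          (by positivity)
    _ = A * Real.exp (-(1 / 4 * u ^ 2)) := by
      rw [mul_assoc, ← Real.exp_add]; ring_nf

lemma integrable_pow_mul_gaussianPDFReal (k : ℕ) :
    Integrable fun u : ℝ => u ^ k * gaussianPDFReal 0 1 u := by
  obtain ⟨A, hA, h⟩ := exists_one_add_abs_pow_mul_gaussianPDFReal_le k
  have hi := (integrable_exp_neg_mul_sq (b := 1 / 4) (by norm_num)).const_mul A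
  refine hi.mono' (continuous_pow_mul_gaussianPDFReal k).aestronglyMeasurable (ae_of_all _ fun u => ?_)
  have h1 : |u| ^ k ≤ (1 + |u|) ^ k := by gcongr; linarith
  rw [norm_mul, norm_pow, Real.norm_eq_abs, Real.norm_of_nonneg (gaussianPDFReal_nonneg _ _ _)]
  refine (mul_le_mul_of_nonneg_right h1 (gaussianPDFReal_nonneg _ _ _)).trans ((h u).trans ?_)
  rw [neg_mul]

lemma integral_gaussianPDFReal_zero_one : ∫ u : ℝ, u ^ 0 * gaussianPDFReal 0 1 u = 1 := by
  simp only [pow_zero, one_mul]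
  exact integral_gaussianPDFReal_eq_one 0 one_ne_zero

lemma integral_id_mul_gaussianPDFReal : ∫ u : ℝ, u ^ 1 * gaussianPDFReal 0 1 u = 0 := by
  have h := integral_gaussianReal_eq_integral_smul (μ := 0) (v := 1) (f := fun x : ℝ => x)
    one_ne_zero
  rw [integral_id_gaussianReal] at h
  simp only [pow_one]
  exact (h.trans (integral_congr_ae (ae_of_all _ fun u => by simp [mul_comm]))).symm

lemma integral_sq_mul_gaussianPDFReal : ∫ u : ℝ, u ^ 2 * gaussianPDFReal 0 1 u = 1 := by
  have h := integral_gaussianReal_eq_integral_smul (μ := 0) (v := 1) (f := fun x : ℝ => x ^ 2)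
    one_ne_zero
  have h2 := variance_id_gaussianReal (μ := 0) (v := 1)
  rw [variance_eq_integral aemeasurable_id] at h2
  simp only [id, integral_id_gaussianReal, sub_zero, NNReal.coe_one] at h2
  rw [h2] at h
  rw [h]
  simp only [smul_eq_mul, mul_comm]

/-- Markov-type bound for the mass of a density outside of a large interval. -/
lemma abs_setIntegral_le_of_le_abs {f : ℝ → ℝ} {s : Set ℝ} {y : ℝ} (hs : MeasurableSet s)
    (hy : 0 < y) (hf : Integrable f) (hf' : Integrable fun u => u * f u) (h : ∀ u ∈ s, y ≤ |u|) :
    |∫ u in s, f u| ≤ (∫ u, |u * f u|) / y := by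
  rw [le_div_iff₀ hy]
  calc |∫ u in s, f u| * y ≤ (∫ u in s, |f u|) * y := by
        gcongr; exact abs_integral_le_integral_abs
    _ = ∫ u in s, |f u| * y := (integral_mul_const _ _).symm
    _ ≤ ∫ u in s, |u * f u| := by
        refine setIntegral_mono_on (hf.abs.mul_const y).integrableOn hf'.abs.integrableOn hs
          fun u hu => ?_
        rw [abs_mul, mul_comm]
        gcongr
        exact h u hu
    _ ≤ ∫ u, |u * f u| := setIntegral_le_integral hf'.abs (ae_of_all _ fun u => abs_nonneg _)

lemma exists_tail_pow_mul_gaussianPDFReal_le (k : ℕ) :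
    ∃ A : ℝ, 0 < A ∧ ∀ (s : Set ℝ) (y : ℝ), MeasurableSet s → 0 < y → (∀ u ∈ s, y ≤ |u|) →
      |∫ u in s, u ^ k * gaussianPDFReal 0 1 u| ≤ A / y := by
  refine ⟨(∫ u : ℝ, |u * (u ^ k * gaussianPDFReal 0 1 u)|) + 1, ?_, fun s y hs hy h => ?_⟩
  · have : 0 ≤ ∫ u : ℝ, |u * (u ^ k * gaussianPDFReal 0 1 u)| :=
      integral_nonneg fun u => abs_nonneg _
    linarith
  · refine (abs_setIntegral_le_of_le_abs hs hy (integrable_pow_mul_gaussianPDFReal k) ?_ h).trans ?_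
    · simpa only [pow_succ', mul_assoc] using integrable_pow_mul_gaussianPDFReal (k + 1)
    · gcongr; linarith

/-- Since u² ≤ 2t² + 2(t-u)², Gaussian decay at a grid point passes to its whole cell at the cost of
half the rate. -/
lemma exp_neg_mul_sq_le_of_abs_sub_le_one {c t u : ℝ} (hc : 0 ≤ c) (h : |t - u| ≤ 1) :
    Real.exp (-(c * t ^ 2)) ≤ Real.exp c * Real.exp (-(c / 2 * u ^ 2)) := by
  rw [← Real.exp_add]
  refine Real.exp_le_exp.2 ?_
  have h1 : (t - u) ^ 2 ≤ 1 := by rw [← sq_abs]; nlinarith [abs_nonneg (t - u)]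
  nlinarith [mul_nonneg hc (sq_nonneg (u - 2 * t)), mul_nonneg hc (sub_nonneg.2 h1)]

/-- Mean value inequality on the cell; the derivative is a polynomial times the density, hence
decays like a Gaussian. -/
lemma exists_abs_pow_mul_gaussianPDFReal_sub_le (k : ℕ) :
    ∃ C : ℝ, 0 < C ∧ ∀ h t u : ℝ, h ≤ 1 → u ∈ Set.Icc t (t + h) →
      |t ^ k * gaussianPDFReal 0 1 t - u ^ k * gaussianPDFReal 0 1 u|
        ≤ C * h * Real.exp (-(1 / 8 * u ^ 2)) := by
  obtain ⟨A, hA, hle⟩ := exists_one_add_abs_pow_mul_gaussianPDFReal_le (k + 1)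
  refine ⟨(k + 1) * A * Real.exp (1 / 4), by positivity, fun h t u hh hu => ?_⟩
  have hder : ∀ ξ : ℝ, HasDerivAt (fun u : ℝ => u ^ k * gaussianPDFReal 0 1 u)
      (k * ξ ^ (k - 1) * gaussianPDFReal 0 1 ξ + ξ ^ k * (-ξ * gaussianPDFReal 0 1 ξ)) ξ :=
    fun ξ => (hasDerivAt_pow k ξ).mul (hasDerivAt_gaussianPDFReal_zero_one ξ)
  have hbd : ∀ ξ ∈ Set.Icc t (t + h), ‖deriv (fun u : ℝ => u ^ k * gaussianPDFReal 0 1 u) ξ‖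
      ≤ (k + 1) * A * Real.exp (1 / 4) * Real.exp (-(1 / 8 * u ^ 2)) := by
    intro ξ hξ
    rw [(hder ξ).deriv]
    have h1 : |ξ| ^ (k - 1) ≤ (1 + |ξ|) ^ (k + 1) :=
      (pow_le_pow_left₀ (abs_nonneg ξ) (by linarith) _).trans
        (pow_le_pow_right₀ (by linarith [abs_nonneg ξ]) (by omega))
    have h2 : |ξ| ^ k * |ξ| ≤ (1 + |ξ|) ^ (k + 1) := by
      rw [← pow_succ]
      exact pow_le_pow_left₀ (abs_nonneg ξ) (by linarith) _
    have hφ := gaussianPDFReal_nonneg 0 1 ξ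
    have h3 : ‖k * ξ ^ (k - 1) * gaussianPDFReal 0 1 ξ + ξ ^ k * (-ξ * gaussianPDFReal 0 1 ξ)‖
        ≤ (k + 1) * ((1 + |ξ|) ^ (k + 1) * gaussianPDFReal 0 1 ξ) := by
      refine (norm_add_le _ _).trans ?_
      simp only [norm_mul, norm_pow, norm_neg, Real.norm_eq_abs, abs_of_nonneg hφ, Nat.abs_cast]
      have e1 := mul_le_mul_of_nonneg_right
        (mul_le_mul_of_nonneg_left h1 (Nat.cast_nonneg (α := ℝ) k)) hφ
      have e2 := mul_le_mul_of_nonneg_right h2 hφ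
      linarith
    have h4 := mul_le_mul_of_nonneg_left (hle ξ) (by positivity : (0 : ℝ) ≤ k + 1)
    have h5 := exp_neg_mul_sq_le_of_abs_sub_le_one (c := 1 / 4) (t := ξ) (u := u) (by norm_num)
      (by rw [abs_le]; constructor <;> linarith [hξ.1, hξ.2, hu.1, hu.2])
    have h6 := mul_le_mul_of_nonneg_left h5 (by positivity : (0 : ℝ) ≤ (k + 1) * A)
    rw [show (1 : ℝ) / 4 / 2 = 1 / 8 by norm_num] at h6
    linarith
  have hmv := (convex_Icc t (t + h)).norm_image_sub_le_of_norm_deriv_le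
    (fun ξ _ => (hder ξ).differentiableAt) hbd hu ⟨le_refl t, hu.1.trans hu.2⟩
  rw [Real.norm_eq_abs, Real.norm_eq_abs] at hmv
  refine hmv.trans ?_
  have h7 : |t - u| ≤ h := by rw [abs_le]; constructor <;> linarith [hu.1, hu.2]
  calc _ ≤ (k + 1) * A * Real.exp (1 / 4) * Real.exp (-(1 / 8 * u ^ 2)) * h := by gcongr
    _ = _ := by ring

/-! ### Riemann sums of nearly Gaussian weights. -/

/-- Comparison of an approximate Gaussian weight at a grid point with the Gaussian density on the
adjacent cell. -/
lemma exists_abs_mul_pow_sub_pow_mul_gaussianPDFReal_le (k : ℕ) {K c : ℝ} (hK : 0 < K)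
    (hc : 0 < c) :
    ∃ C c' : ℝ, 0 < C ∧ 0 < c' ∧ ∀ h t w u : ℝ, 0 < h → h ≤ 1 →
      |w - gaussianPDFReal 0 1 t| ≤ K * h * Real.exp (-(c * t ^ 2)) → u ∈ Set.Icc t (t + h) →
      |w * t ^ k - u ^ k * gaussianPDFReal 0 1 u| ≤ C * h * Real.exp (-c' * u ^ 2) := by
  obtain ⟨C, hC, hder⟩ := exists_abs_pow_mul_gaussianPDFReal_sub_le k
  obtain ⟨A, hA, hpoly⟩ := exists_one_add_abs_pow_le_mul_exp k (c := c / 2) (by positivity)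
  -- The 1/8 is the decay of the density's variation. The c/4 is what remains of c after one half
  -- absorbs the power of t and the passage from t to u halves the rest.
  set c' := min (1 / 8) (c / 4) with hc'
  have hc'1 : c' ≤ 1 / 8 := min_le_left _ _
  have hc'2 : c' ≤ c / 4 := min_le_right _ _
  refine ⟨K * A * Real.exp (c / 2) + C, c', by positivity, by positivity,
    fun h t w u hh0 hh1 hw hu => ?_⟩
  have h1 := hder h t u hh1 hu
  have h2 : |(w - gaussianPDFReal 0 1 t) * t ^ k|
      ≤ K * A * Real.exp (c / 2) * h * Real.exp (-c' * u ^ 2) := by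
    rw [abs_mul, abs_pow]
    have h3 : |t| ^ k ≤ A * Real.exp (c / 2 * t ^ 2) :=
      (pow_le_pow_left₀ (abs_nonneg t) (by linarith) _).trans (hpoly t)
    have h4 := exp_neg_mul_sq_le_of_abs_sub_le_one (c := c / 2) (t := t) (u := u) (by positivity)
      (by rw [abs_le]; constructor <;> linarith [hu.1, hu.2])
    have h5 : Real.exp (-(c / 2 / 2 * u ^ 2)) ≤ Real.exp (-c' * u ^ 2) :=
      Real.exp_le_exp.2 (by nlinarith [mul_nonneg (sub_nonneg.2 hc'2) (sq_nonneg u)])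
    have h6 : Real.exp (-(c * t ^ 2)) * Real.exp (c / 2 * t ^ 2) = Real.exp (-(c / 2 * t ^ 2)) := by
      rw [← Real.exp_add]; ring_nf
    calc |w - gaussianPDFReal 0 1 t| * |t| ^ k
        ≤ (K * h * Real.exp (-(c * t ^ 2))) * (A * Real.exp (c / 2 * t ^ 2)) :=
          mul_le_mul hw h3 (by positivity) (by positivity)
      _ = K * h * A * (Real.exp (-(c * t ^ 2)) * Real.exp (c / 2 * t ^ 2)) := by ring
      _ ≤ K * h * A * (Real.exp (c / 2) * Real.exp (-c' * u ^ 2)) := by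
        rw [h6]
        exact mul_le_mul_of_nonneg_left
          (h4.trans (mul_le_mul_of_nonneg_left h5 (Real.exp_pos _).le)) (by positivity)
      _ = _ := by ring
  have h7 : C * h * Real.exp (-(1 / 8 * u ^ 2)) ≤ C * h * Real.exp (-c' * u ^ 2) :=
    mul_le_mul_of_nonneg_left
      (Real.exp_le_exp.2 (by nlinarith [mul_nonneg (sub_nonneg.2 hc'1) (sq_nonneg u)]))
      (by positivity)
  have h8 : w * t ^ k - u ^ k * gaussianPDFReal 0 1 u = (w - gaussianPDFReal 0 1 t) * t ^ k
      + (t ^ k * gaussianPDFReal 0 1 t - u ^ k * gaussianPDFReal 0 1 u) := by ring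
  rw [h8]
  refine (abs_add_le _ _).trans ?_
  linarith

/-- Riemann sums of approximate Gaussian weights. -/
lemma exists_abs_sum_sub_integral_le (k : ℕ) {K c : ℝ} (hK : 0 < K) (hc : 0 < c) :
    ∃ C : ℝ, 0 < C ∧ ∀ (h : ℝ) (t W : ℕ → ℝ) (m : ℕ), 0 < h → h ≤ 1 → (∀ j, t (j + 1) = t j + h) →
      (∀ j < m, |W j - gaussianPDFReal 0 1 (t j)| ≤ K * h * Real.exp (-(c * t j ^ 2))) →
      |h * ∑ j ∈ Finset.range m, W j * t j ^ k
        - ∫ u in t 0..t m, u ^ k * gaussianPDFReal 0 1 u| ≤ C * h := by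
  obtain ⟨C, c', hC, hc', hcell⟩ := exists_abs_mul_pow_sub_pow_mul_gaussianPDFReal_le k hK hc
  refine ⟨C * Real.sqrt (Real.pi / c'), by positivity, fun h t W m hh0 hh1 ht hW => ?_⟩
  have hmono : Monotone t := monotone_nat_of_le_succ fun j => by rw [ht]; linarith
  have hint : ∀ a b : ℝ, IntervalIntegrable (fun u : ℝ => u ^ k * gaussianPDFReal 0 1 u) volume a b :=
    fun a b => (continuous_pow_mul_gaussianPDFReal k).intervalIntegrable a b
  have hintE : Integrable fun u : ℝ => C * h * Real.exp (-c' * u ^ 2) :=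
    (integrable_exp_neg_mul_sq hc').const_mul _
  -- Each summand is the integral of a constant over its cell, so the error is a sum of cell
  -- integrals dominated by one Gaussian integral over ℝ. The bound is thus uniform in m.
  have h1 : h * ∑ j ∈ Finset.range m, W j * t j ^ k
      - ∫ u in t 0..t m, u ^ k * gaussianPDFReal 0 1 u
      = ∑ j ∈ Finset.range m, ∫ u in t j..t (j + 1),
        (W j * t j ^ k - u ^ k * gaussianPDFReal 0 1 u) := by
    rw [← intervalIntegral.sum_integral_adjacent_intervals fun j _ => hint _ _, Finset.mul_sum,
      ← Finset.sum_sub_distrib]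
    refine Finset.sum_congr rfl fun j _ => ?_
    rw [intervalIntegral.integral_sub intervalIntegrable_const (hint _ _),
      intervalIntegral.integral_const, ht, add_sub_cancel_left, smul_eq_mul]
  have h2 : ∀ j ∈ Finset.range m,
      |∫ u in t j..t (j + 1), (W j * t j ^ k - u ^ k * gaussianPDFReal 0 1 u)|
        ≤ ∫ u in t j..t (j + 1), C * h * Real.exp (-c' * u ^ 2) := by
    intro j hj
    rw [← Real.norm_eq_abs]
    refine intervalIntegral.norm_integral_le_of_norm_le (hmono (Nat.le_succ j))
      (ae_of_all _ fun u hu => ?_) hintE.intervalIntegrable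
    rw [ht] at hu
    exact hcell h (t j) (W j) u hh0 hh1 (hW j (Finset.mem_range.1 hj)) ⟨hu.1.le, hu.2⟩
  rw [h1]
  refine (Finset.abs_sum_le_sum_abs _ _).trans ((Finset.sum_le_sum h2).trans ?_)
  rw [intervalIntegral.sum_integral_adjacent_intervals fun j _ => hintE.intervalIntegrable,
    intervalIntegral.integral_of_le (hmono (Nat.zero_le m))]
  refine (setIntegral_le_integral hintE (ae_of_all _ fun u => by positivity)).trans ?_
  rw [integral_const_mul, integral_gaussian]
  exact le_of_eq (by ring)

/-! ### Regularity of Φ. -/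

lemma stdNormalCDF_eq (z : ℝ) : stdNormalCDF z = ∫ u in Set.Iic z, gaussianPDFReal 0 1 u := by
  unfold stdNormalCDF
  simp only [gaussianPDFReal_zero_one, one_div]

lemma integrable_gaussianPDFReal_zero_one : Integrable (gaussianPDFReal 0 1) :=
  integrable_gaussianPDFReal 0 1

lemma stdNormalCDF_sub (a b : ℝ) :
    stdNormalCDF b - stdNormalCDF a = ∫ u in a..b, gaussianPDFReal 0 1 u := by
  rw [stdNormalCDF_eq, stdNormalCDF_eq]
  exact intervalIntegral.integral_Iic_sub_Iic integrable_gaussianPDFReal_zero_one.integrableOn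
    integrable_gaussianPDFReal_zero_one.integrableOn

lemma stdNormalCDF_nonneg (z : ℝ) : 0 ≤ stdNormalCDF z := by
  rw [stdNormalCDF_eq]
  exact integral_nonneg fun u => gaussianPDFReal_nonneg _ _ _

lemma stdNormalCDF_le_one (z : ℝ) : stdNormalCDF z ≤ 1 := by
  rw [stdNormalCDF_eq]
  refine (setIntegral_le_integral integrable_gaussianPDFReal_zero_one
    (ae_of_all _ fun u => gaussianPDFReal_nonneg _ _ _)).trans ?_
  rw [integral_gaussianPDFReal_eq_one 0 one_ne_zero]

lemma abs_stdNormalCDF_sub_le (a b : ℝ) : |stdNormalCDF b - stdNormalCDF a| ≤ |b - a| := by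
  rw [stdNormalCDF_sub]
  have h := intervalIntegral.norm_integral_le_of_norm_le_const (a := a) (b := b) (C := 1)
    (f := gaussianPDFReal 0 1) fun u _ => by
    rw [Real.norm_of_nonneg (gaussianPDFReal_nonneg _ _ _)]
    exact gaussianPDFReal_zero_one_le_one u
  rwa [one_mul, Real.norm_eq_abs] at h

/-- Uniformity in z holds because |u| ≥ |z|/2 between z and zs: the density there is at most
exp(-z²/8), which compensates the interval length |z||s-1|. -/
lemma abs_stdNormalCDF_mul_sub_le {s : ℝ} (hs : |s - 1| ≤ 1 / 2) (z : ℝ) :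
    |stdNormalCDF (z * s) - stdNormalCDF z| ≤ 2 * |s - 1| := by
  rw [stdNormalCDF_sub]
  have hs' := abs_le.1 hs
  have h := intervalIntegral.norm_integral_le_of_norm_le_const (a := z) (b := z * s)
    (C := Real.exp (-(z ^ 2 / 8))) (f := gaussianPDFReal 0 1) fun u hu => by
    rw [Real.norm_of_nonneg (gaussianPDFReal_nonneg _ _ _)]
    refine (gaussianPDFReal_zero_one_le_exp u).trans (Real.exp_le_exp.2 ?_)
    have h1 : (z / 2) ^ 2 ≤ u ^ 2 := by
      rw [sq_le_sq]
      have hu' := Set.uIoc_subset_uIcc hu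
      rcases le_total 0 z with hz | hz
      · have : z / 2 ≤ u := by
          rcases Set.mem_uIcc.1 hu' with ⟨h1, h2⟩ | ⟨h1, h2⟩ <;> nlinarith
        rw [abs_of_nonneg (by linarith)]
        exact this.trans (le_abs_self u)
      · have : u ≤ z / 2 := by
          rcases Set.mem_uIcc.1 hu' with ⟨h1, h2⟩ | ⟨h1, h2⟩ <;> nlinarith
        rw [abs_of_nonpos (by linarith)]
        exact (neg_le_neg this).trans (neg_le_abs u)
    linarith
  rw [Real.norm_eq_abs] at h
  refine h.trans ?_
  rw [show z * s - z = z * (s - 1) by ring, abs_mul, ← mul_assoc]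
  refine mul_le_mul_of_nonneg_right ?_ (abs_nonneg _)
  have h2 := Real.add_one_le_exp (z ^ 2 / 8)
  rw [Real.exp_neg, inv_mul_le_iff₀ (Real.exp_pos _)]
  have h3 : |z| ≤ 2 * (z ^ 2 / 8 + 1) := by
    rw [← sq_abs z]; nlinarith [sq_nonneg (|z| - 2)]
  linarith

/-! ### Discrete laws on a grid with nearly Gaussian weights. -/

/-- The grid covers [-b/h, b/h], so a Markov bound makes the missing tails O(h). -/
lemma exists_abs_sum_sub_integral_univ_le (k : ℕ) {K c b : ℝ} (hK : 0 < K) (hc : 0 < c)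
    (hb : 0 < b) :
    ∃ C : ℝ, 0 < C ∧ ∀ (h : ℝ) (t W : ℕ → ℝ) (m : ℕ), 0 < h → h ≤ 1 → (∀ j, t (j + 1) = t j + h) →
      t 0 ≤ -(b / h) → b / h ≤ t m →
      (∀ j < m, |W j - gaussianPDFReal 0 1 (t j)| ≤ K * h * Real.exp (-(c * t j ^ 2))) →
      |h * ∑ j ∈ Finset.range m, W j * t j ^ k - ∫ u, u ^ k * gaussianPDFReal 0 1 u| ≤ C * h := by
  obtain ⟨C, hC, hsum⟩ := exists_abs_sum_sub_integral_le k hK hc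
  obtain ⟨A, hA, htail⟩ := exists_tail_pow_mul_gaussianPDFReal_le k
  refine ⟨C + A / b, by positivity, fun h t W m hh0 hh1 ht ht0 htm hW => ?_⟩
  have hbh : 0 < b / h := by positivity
  have h1 := hsum h t W m hh0 hh1 ht hW
  have h2 := htail (Set.Ioc (t 0) (t m))ᶜ (b / h) measurableSet_Ioc.compl hbh fun u hu => by
    rw [Set.mem_compl_iff, Set.mem_Ioc, not_and_or, not_lt, not_le] at hu
    rcases hu with hu | hu
    · exact le_trans (by linarith) (neg_le_abs u)
    · exact le_trans (by linarith) (le_abs_self u)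
  have h3 := integral_add_compl (measurableSet_Ioc (a := t 0) (b := t m))
    (integrable_pow_mul_gaussianPDFReal k)
  rw [intervalIntegral.integral_of_le (by linarith)] at h1
  have h4 : A / (b / h) = A / b * h := by field_simp
  rw [h4] at h2
  rw [← h3, ← sub_sub]
  refine (abs_sub _ _).trans ?_
  linarith

/-- Along a monotone grid a half-line cuts out an initial segment. The last clause records that the
cut falls short of `m` only when the next grid point exceeds `a`. -/
lemma exists_filter_range_eq_range {t : ℕ → ℝ} (ht : Monotone t) (m : ℕ) (a : ℝ) :
    ∃ J ≤ m, (Finset.range m).filter (fun j => t j ≤ a) = Finset.range J ∧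
      (∀ j < J, t j ≤ a) ∧ (t J ≤ a → J = m) := by
  classical
  have hex : ∃ j, m ≤ j ∨ a < t j := ⟨m, Or.inl le_rfl⟩
  have hmin : ∀ j < Nat.find hex, j < m ∧ t j ≤ a := fun j hj => by
    simpa only [not_or, not_le, not_lt] using Nat.find_min hex hj
  have hle : Nat.find hex ≤ m := Nat.find_min' hex (Or.inl le_rfl)
  refine ⟨Nat.find hex, hle, ?_, fun j hj => (hmin j hj).2, fun h => ?_⟩
  · ext j
    simp only [Finset.mem_filter, Finset.mem_range]
    refine ⟨fun ⟨h1, h2⟩ => ?_, hmin j⟩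
    by_contra hj
    rcases Nat.find_spec hex with h | h
    · omega
    · exact absurd (ht (not_lt.1 hj)) (by linarith)
  · rcases Nat.find_spec hex with h' | h'
    · omega
    · linarith

lemma exists_abs_sum_filter_sub_stdNormalCDF_le {K c b : ℝ} (hK : 0 < K) (hc : 0 < c)
    (hb : 0 < b) :
    ∃ C : ℝ, 0 < C ∧ ∀ (h : ℝ) (t W : ℕ → ℝ) (m : ℕ), 0 < h → h ≤ 1 → (∀ j, t (j + 1) = t j + h) →
      t 0 ≤ -(b / h) → b / h ≤ t m →
      (∀ j < m, |W j - gaussianPDFReal 0 1 (t j)| ≤ K * h * Real.exp (-(c * t j ^ 2))) →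
      ∀ a : ℝ, |h * ∑ j ∈ (Finset.range m).filter (fun j => t j ≤ a), W j - stdNormalCDF a|
        ≤ C * h := by
  obtain ⟨C, hC, hsum⟩ := exists_abs_sum_sub_integral_le 0 hK hc
  obtain ⟨A, hA, htail⟩ := exists_tail_pow_mul_gaussianPDFReal_le 0
  simp only [pow_zero, one_mul, mul_one] at hsum htail
  refine ⟨C + 1 + 2 * (A / b), by positivity, fun h t W m hh0 hh1 ht ht0 htm hW a => ?_⟩
  have hbh : 0 < b / h := by positivity
  have hAb : A / (b / h) = A / b * h := by field_simp
  have hAb0 : 0 < A / b * h := by positivity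
  have hlow : ∀ y ≤ t 0, |stdNormalCDF y| ≤ A / b * h := fun y hy => by
    rw [stdNormalCDF_eq, ← hAb]
    refine htail _ _ measurableSet_Iic hbh fun u hu => ?_
    have : u ≤ y := hu
    exact le_trans (by linarith) (neg_le_abs u)
  have hmono : Monotone t := monotone_nat_of_le_succ fun j => by rw [ht]; linarith
  obtain ⟨J, hJm, hJ, hJlt, hJeq⟩ := exists_filter_range_eq_range hmono m a
  rw [hJ]
  rcases Nat.eq_zero_or_pos J with rfl | hJ0
  -- If `t 0 ≤ a`, an empty segment would force m = 0, contradicting t 0 < 0 < t m. So `a` lies left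
  -- of the grid, where Φ is O(h).
  · have h1 := hlow a (not_lt.1 fun hlt => by
      have h0 := hJeq hlt.le
      subst h0
      linarith)
    simp only [Finset.range_zero, Finset.sum_empty, mul_zero, zero_sub, abs_neg]
    nlinarith
  · obtain ⟨i, rfl⟩ : ∃ i, J = i + 1 := ⟨J - 1, by omega⟩
    have h1 := hsum h t W (i + 1) hh0 hh1 ht fun j hj => hW j (by omega)
    have h2 : |stdNormalCDF (t (i + 1)) - stdNormalCDF a| ≤ h + A / b * h := by
      -- Either `a` lies in the last cell used, within h of its right end, or it lies beyond the
      -- whole grid, where only a tail remains.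
      rcases lt_or_ge a (t (i + 1)) with hlt | hge
      · have h3 := hJlt i (by omega)
        have h4 := abs_stdNormalCDF_sub_le a (t (i + 1))
        rw [abs_of_pos (by linarith : 0 < t (i + 1) - a)] at h4
        have := ht i
        linarith
      · have h3 := hJeq hge
        rw [abs_sub_comm, stdNormalCDF_sub, intervalIntegral.integral_of_le hge]
        have h4 := htail (Set.Ioc (t (i + 1)) a) (b / h) measurableSet_Ioc hbh fun u hu => by
          rw [h3] at hu
          exact le_trans (by linarith [hu.1]) (le_abs_self u)
        linarith
    have h5 := hlow (t 0) le_rfl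
    rw [← stdNormalCDF_sub] at h1
    have h6 : h * ∑ j ∈ Finset.range (i + 1), W j - stdNormalCDF a
        = (h * ∑ j ∈ Finset.range (i + 1), W j - (stdNormalCDF (t (i + 1)) - stdNormalCDF (t 0)))
          + (stdNormalCDF (t (i + 1)) - stdNormalCDF a) - stdNormalCDF (t 0) := by ring
    rw [h6]
    refine (abs_sub _ _).trans ?_
    have := abs_add_le
      (h * ∑ j ∈ Finset.range (i + 1), W j - (stdNormalCDF (t (i + 1)) - stdNormalCDF (t 0)))
      (stdNormalCDF (t (i + 1)) - stdNormalCDF a)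
    linarith

/-- Stability of the standardized normal distribution function under perturbations of the mass and
of the first two moments. -/
lemma abs_div_sub_stdNormalCDF_le {ε T₀ T₁ T₂ μ v : ℝ} (hε0 : 0 < ε) (hε1 : ε ≤ 1 / 16)
    (e0 : |T₀ - 1| ≤ ε) (e1 : |T₁| ≤ ε) (e2 : |T₂ - 1| ≤ ε) (hμ : μ = T₁ / T₀)
    (hv : v = T₂ / T₀ - μ ^ 2) :
    0 < v ∧ ∀ z Q : ℝ, |Q - stdNormalCDF (μ + z * Real.sqrt v)| ≤ ε →
      |Q / T₀ - stdNormalCDF z| ≤ 22 * ε := by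
  have a0 := abs_le.1 e0
  have hT₀2 : 1 / 2 ≤ T₀ := by linarith
  have hT₀0 : 0 < T₀ := by linarith
  have hμ1 : |μ| ≤ 2 * ε := by
    rw [hμ, abs_div, abs_of_pos hT₀0, div_le_iff₀ hT₀0]
    nlinarith
  have hv1 : |v - 1| ≤ 5 * ε := by
    have h1 : |T₂ / T₀ - 1| ≤ 4 * ε := by
      rw [div_sub_one hT₀0.ne', abs_div, abs_of_pos hT₀0, div_le_iff₀ hT₀0]
      have : |T₂ - T₀| ≤ 2 * ε := by
        have a2 := abs_le.1 e2
        rw [abs_le]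
        constructor <;> linarith
      nlinarith
    have h2 : μ ^ 2 ≤ ε := by
      rw [← sq_abs]
      nlinarith [abs_nonneg μ]
    have a1 := abs_le.1 h1
    rw [hv, abs_le]
    constructor <;> nlinarith [sq_nonneg μ]
  have hv0 : 0 < v := by linarith [(abs_le.1 hv1).1]
  refine ⟨hv0, fun z Q e3 => ?_⟩
  set s := Real.sqrt v with hs
  have hs0 : 0 ≤ s := Real.sqrt_nonneg v
  have hss : v = s ^ 2 := (Real.sq_sqrt hv0.le).symm
  have hs1 : |s - 1| ≤ 5 * ε := by
    refine le_trans ?_ hv1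
    rw [hss, show s ^ 2 - 1 = (s - 1) * (s + 1) by ring, abs_mul, abs_of_nonneg (by linarith :
      0 ≤ s + 1)]
    exact le_mul_of_one_le_right (abs_nonneg _) (by linarith)
  set a := μ + z * s with ha
  have g1 : |Q / T₀ - stdNormalCDF a| ≤ 4 * ε := by
    rw [div_sub' hT₀0.ne', abs_div, abs_of_pos hT₀0, div_le_iff₀ hT₀0]
    have h1 : |(T₀ - 1) * stdNormalCDF a| ≤ ε := by
      rw [abs_mul, abs_of_nonneg (stdNormalCDF_nonneg a)]
      nlinarith [stdNormalCDF_nonneg a, stdNormalCDF_le_one a, abs_nonneg (T₀ - 1)]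
    have h2 : Q - T₀ * stdNormalCDF a = (Q - stdNormalCDF a) - (T₀ - 1) * stdNormalCDF a := by ring
    rw [h2]
    refine (abs_sub _ _).trans ?_
    nlinarith [e3]
  have g2 := abs_stdNormalCDF_sub_le (z * s) a
  have g3 := abs_stdNormalCDF_mul_sub_le (hs1.trans (by linarith)) z
  rw [show a - z * s = μ by rw [ha]; ring] at g2
  -- The three terms cost 4ε for the normalization, 2ε for the shift by μ and 10ε for the scaling by
  -- s, within the stated 22ε.
  have g4 : Q / T₀ - stdNormalCDF z = (Q / T₀ - stdNormalCDF a)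
      + (stdNormalCDF a - stdNormalCDF (z * s)) + (stdNormalCDF (z * s) - stdNormalCDF z) := by ring
  rw [g4]
  refine (abs_add_le _ _).trans ?_
  have := abs_add_le (Q / T₀ - stdNormalCDF a) (stdNormalCDF a - stdNormalCDF (z * s))
  linarith

/-- The distribution function of a discrete law, whose weights on a grid of mesh `h` are close to
the Gaussian density, is close to `Φ` after centering and scaling by its own mean `μ` and standard
deviation. -/
lemma exists_abs_sum_filter_div_sub_stdNormalCDF_le {K c b : ℝ} (hK : 0 < K) (hc : 0 < c)
    (hb : 0 < b) :
    ∃ C h₀ : ℝ, 0 < C ∧ 0 < h₀ ∧ ∀ (h : ℝ) (t W : ℕ → ℝ) (m : ℕ), 0 < h → h ≤ h₀ →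
      (∀ j, t (j + 1) = t j + h) → t 0 ≤ -(b / h) → b / h ≤ t m →
      (∀ j < m, |W j - gaussianPDFReal 0 1 (t j)| ≤ K * h * Real.exp (-(c * t j ^ 2))) →
      ∀ μ v : ℝ, μ = (∑ j ∈ Finset.range m, W j * t j) / ∑ j ∈ Finset.range m, W j →
        v = (∑ j ∈ Finset.range m, W j * t j ^ 2) / (∑ j ∈ Finset.range m, W j) - μ ^ 2 →
        0 < v ∧ ∀ z : ℝ,
          |(∑ j ∈ (Finset.range m).filter (fun j => t j ≤ μ + z * Real.sqrt v), W j)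
            / (∑ j ∈ Finset.range m, W j) - stdNormalCDF z| ≤ C * h := by
  obtain ⟨C₀, hC₀, H₀⟩ := exists_abs_sum_sub_integral_univ_le 0 hK hc hb
  obtain ⟨C₁, hC₁, H₁⟩ := exists_abs_sum_sub_integral_univ_le 1 hK hc hb
  obtain ⟨C₂, hC₂, H₂⟩ := exists_abs_sum_sub_integral_univ_le 2 hK hc hb
  obtain ⟨C₃, hC₃, H₃⟩ := exists_abs_sum_filter_sub_stdNormalCDF_le hK hc hb
  rw [integral_gaussianPDFReal_zero_one] at H₀
  rw [integral_id_mul_gaussianPDFReal] at H₁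
  rw [integral_sq_mul_gaussianPDFReal] at H₂
  simp only [pow_zero, mul_one] at H₀
  simp only [pow_one, sub_zero] at H₁
  set L := C₀ + C₁ + C₂ + C₃ + 1 with hL
  have hL0 : 0 < L := by positivity
  refine ⟨22 * L, 1 / (16 * L), by positivity, by positivity,
    fun h t W m hh0 hh ht ht0 htm hW μ v hμ hv => ?_⟩
  have hLh : L * h ≤ 1 / 16 := by
    have := mul_le_mul_of_nonneg_left hh hL0.le
    rwa [show L * (1 / (16 * L)) = 1 / 16 by field_simp] at this
  have hh1 : h ≤ 1 := by nlinarith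
  set ε := L * h with hε
  have hε0 : 0 < ε := by positivity
  have e0 : |h * ∑ j ∈ Finset.range m, W j - 1| ≤ ε :=
    (H₀ h t W m hh0 hh1 ht ht0 htm hW).trans (mul_le_mul_of_nonneg_right (by linarith) hh0.le)
  have e1 : |h * ∑ j ∈ Finset.range m, W j * t j| ≤ ε :=
    (H₁ h t W m hh0 hh1 ht ht0 htm hW).trans (mul_le_mul_of_nonneg_right (by linarith) hh0.le)
  have e2 : |h * ∑ j ∈ Finset.range m, W j * t j ^ 2 - 1| ≤ ε :=
    (H₂ h t W m hh0 hh1 ht ht0 htm hW).trans (mul_le_mul_of_nonneg_right (by linarith) hh0.le)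
  have e3 : ∀ a, |h * ∑ j ∈ (Finset.range m).filter (fun j => t j ≤ a), W j - stdNormalCDF a| ≤ ε :=
    fun a => (H₃ h t W m hh0 hh1 ht ht0 htm hW a).trans
      (mul_le_mul_of_nonneg_right (by linarith) hh0.le)
  rw [← mul_div_mul_left _ _ hh0.ne'] at hμ hv
  obtain ⟨hv0, hQ⟩ := abs_div_sub_stdNormalCDF_le hε0 hLh e0 e1 e2 hμ hv
  refine ⟨hv0, fun z => ?_⟩
  -- Ratios of sums are unchanged when numerator and denominator are both multiplied by the mesh.
  rw [← mul_div_mul_left _ _ hh0.ne', mul_assoc]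
  exact hQ z _ (e3 _)

/-! ### Application to the fractional binomial distribution. -/

lemma integral_fracBinom {α x : ℝ} (hα : 0 < α) (hx : x ∈ Set.Ioo (0 : ℝ) 1) (n : ℕ)
    (g : ℝ → ℝ) : ∫ y, g y ∂fracBinom α x n =
      (∑ j ∈ Finset.range (n + 1), fracBinomWeight α x n j * g j)
        / ∑ j ∈ Finset.range (n + 1), fracBinomWeight α x n j := by
  have hZ := fracBinomZ_pos hα ⟨hx.1.le, hx.2.le⟩ n
  unfold fracBinom
  rw [integral_finsetSum_measure fun j _ =>
    (integrable_dirac (by simp)).smul_measure ENNReal.ofReal_ne_top, Finset.sum_div]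
  refine Finset.sum_congr rfl fun j hj => ?_
  have hw := fracBinomWeight_pos hα hx (Nat.lt_succ_iff.1 (Finset.mem_range.1 hj))
  rw [integral_smul_measure, integral_dirac, ENNReal.toReal_ofReal (by positivity), smul_eq_mul]
  unfold fracBinomZ
  rw [div_mul_eq_div_div, div_self hα.ne']
  ring

lemma measureReal_fracBinom {α x : ℝ} (hα : 0 < α) (hx : x ∈ Set.Ioo (0 : ℝ) 1) (n : ℕ)
    {p : ℝ → Prop} [DecidablePred p] (hp : MeasurableSet {y | p y}) :
    (fracBinom α x n).real {y | p y} =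
      (∑ j ∈ (Finset.range (n + 1)).filter (fun j : ℕ => p j), fracBinomWeight α x n j)
        / ∑ j ∈ Finset.range (n + 1), fracBinomWeight α x n j := by
  rw [← integral_indicator_one hp, integral_fracBinom hα hx, Finset.sum_filter]
  congr 1
  refine Finset.sum_congr rfl fun j _ => ?_
  by_cases h : p j <;> simp [Set.indicator, h]

/-- Rescaled weights of the fractional binomial distribution are close to the Gaussian density. -/
lemma exists_abs_rescaled_fracBinomWeight_sub_le {α x : ℝ} (hα : 0 < α)
    (hx : x ∈ Set.Ioo (0 : ℝ) 1) :
    ∃ K c : ℝ, 0 < K ∧ 0 < c ∧ ∀ n : ℕ, 4 ≤ n * x → 4 ≤ n * (1 - x) →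
      ∃ κ : ℝ, 0 < κ ∧ ∀ h : ℝ, h = Real.sqrt (α / (x * (1 - x)) / n) → ∀ j ≤ n,
        |κ * fracBinomWeight α x n j - gaussianPDFReal 0 1 ((j - n * x) * h)|
          ≤ K * h * Real.exp (-(c * ((j - n * x) * h) ^ 2)) := by
  obtain ⟨K, hK, hw⟩ := abs_fracBinomWeight_div_sub_exp_le hα hx
  have hx0 := hx.1
  have hx1 : 0 < 1 - x := by linarith [hx.2]
  set β := α / (x * (1 - x)) with hβ
  have hβ0 : 0 < β := by positivity
  refine ⟨K / Real.sqrt β, α / 4 / β, by positivity, by positivity, fun n hnx hny => ?_⟩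
  have hn : (0 : ℝ) < n := by
    by_contra h
    have h0 : (n : ℝ) = 0 := le_antisymm (not_lt.1 h) (by positivity)
    rw [h0] at hnx
    linarith
  have hkn : ⌊n * x⌋₊ ≤ n := by
    have : (⌊n * x⌋₊ : ℝ) ≤ n := (Nat.floor_le (by positivity)).trans (by nlinarith)
    exact_mod_cast this
  have hwk := fracBinomWeight_pos hα hx hkn
  -- κ matches the weight at ⌊nx⌋ with the density at 0. It need not be the true normalization,
  -- since it cancels in every ratio.
  refine ⟨(Real.sqrt (2 * Real.pi))⁻¹ / fracBinomWeight α x n ⌊n * x⌋₊, by positivity,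
    fun h hh j hj => ?_⟩
  have hd := hw n j hnx hny hj
  set d : ℝ := (j : ℝ) - n * x with hd'
  have hh2 : h ^ 2 = β / n := by rw [hh]; exact Real.sq_sqrt (by positivity)
  have hsq : (d * h) ^ 2 = β * d ^ 2 / n := by rw [mul_pow, hh2]; ring
  have h1 : -(β * d ^ 2 / (2 * n)) = -(d * h) ^ 2 / 2 := by rw [hsq]; field_simp
  have h2 : α / 4 * (d ^ 2 / n) = α / 4 / β * (d * h) ^ 2 := by rw [hsq]; field_simp
  have h3 : K / Real.sqrt n = K / Real.sqrt β * h := by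
    rw [hh, Real.sqrt_div hβ0.le]
    have := Real.sqrt_pos.2 hβ0
    field_simp
  rw [h1, h2, h3] at hd
  rw [gaussianPDFReal_zero_one, div_mul_eq_mul_div, mul_div_assoc, ← mul_sub, abs_mul,
    abs_of_nonneg (by positivity)]
  exact (mul_le_of_le_one_left (abs_nonneg _) inv_sqrt_two_pi_le_one).trans hd

lemma fracBinom_berryEsseen_of_large {α x : ℝ} (hα : 0 < α) (hx : x ∈ Set.Ioo (0 : ℝ) 1) :
    ∃ C : ℝ, 0 < C ∧ ∃ N : ℕ, ∀ n : ℕ, N ≤ n → ∀ M V : ℝ,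
      M = ∫ y, y ∂fracBinom α x n → V = ∫ y, (y - M) ^ 2 ∂fracBinom α x n → ∀ z : ℝ,
        |(fracBinom α x n).real {y | (y - M) / Real.sqrt V ≤ z} - stdNormalCDF z|
          ≤ C / Real.sqrt n := by
  classical
  obtain ⟨K, c, hK, hc, hloc⟩ := exists_abs_rescaled_fracBinomWeight_sub_le hα hx
  have hx0 := hx.1
  have hx1 : 0 < 1 - x := by linarith [hx.2]
  set β := α / (x * (1 - x)) with hβ
  have hβ0 : 0 < β := by positivity
  -- As h² = β/n, one has nh = β/h. The grid runs from -nxh to (n+1-nx)h and so covers ±b/h for b =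
  -- β min(x, 1-x).
  have hb0 : 0 < β * min x (1 - x) := mul_pos hβ0 (lt_min hx0 hx1)
  obtain ⟨C, h₀, hC, hh₀, hmain⟩ := exists_abs_sum_filter_div_sub_stdNormalCDF_le hK hc hb0
  refine ⟨C * Real.sqrt β, by positivity, ⌈4 / x + 4 / (1 - x) + β / h₀ ^ 2⌉₊,
    fun n hnN M V hM hV z => ?_⟩
  have hnN' : 4 / x + 4 / (1 - x) + β / h₀ ^ 2 ≤ n := Nat.ceil_le.1 hnN
  have p1 : 0 < 4 / x := by positivity
  have p2 : 0 < 4 / (1 - x) := by positivity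
  have p3 : 0 < β / h₀ ^ 2 := by positivity
  have hn : (0 : ℝ) < n := by linarith
  have hnx : 4 ≤ n * x := by
    rw [← div_le_iff₀ hx0]; linarith
  have hny : 4 ≤ n * (1 - x) := by
    rw [← div_le_iff₀ hx1]; linarith
  obtain ⟨κ, hκ, hW⟩ := hloc n hnx hny
  set h := Real.sqrt (β / n) with hh
  have hh0 : 0 < h := Real.sqrt_pos.2 (by positivity)
  have hh2 : h ^ 2 = β / n := Real.sq_sqrt (by positivity)
  have hhle : h ≤ h₀ := by
    refine Real.sqrt_le_iff.2 ⟨hh₀.le, ?_⟩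
    rw [div_le_iff₀ hn, mul_comm, ← div_le_iff₀ (by positivity)]
    linarith
  have hbound : C * h = C * Real.sqrt β / Real.sqrt n := by
    rw [hh, Real.sqrt_div hβ0.le, mul_div_assoc]
  set w := fracBinomWeight α x n with hw
  set S := ∑ j ∈ Finset.range (n + 1), w j with hS
  have hS0 : 0 < S := Finset.sum_pos
    (fun j hj => fracBinomWeight_pos hα hx (Nat.lt_succ_iff.1 (Finset.mem_range.1 hj))) (by simp)
  rw [integral_fracBinom hα hx n fun y => y, ← hw, ← hS, eq_div_iff hS0.ne'] at hM
  rw [integral_fracBinom hα hx n fun y => (y - M) ^ 2, ← hw, ← hS, eq_div_iff hS0.ne'] at hV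
  have hsum0 : ∑ j ∈ Finset.range (n + 1), κ * w j = κ * S := by rw [hS, Finset.mul_sum]
  have hsum1 : ∑ j ∈ Finset.range (n + 1), κ * w j * ((j - n * x) * h)
      = κ * S * ((M - n * x) * h) := by
    have : κ * S * ((M - n * x) * h) = κ * h * (M * S - n * x * S) := by ring
    rw [this, hM, hS, Finset.mul_sum, ← Finset.sum_sub_distrib, Finset.mul_sum]
    exact Finset.sum_congr rfl fun j _ => by ring
  have hsum2 : ∑ j ∈ Finset.range (n + 1), κ * w j * ((j - n * x) * h) ^ 2
      = κ * S * (h ^ 2 * V + ((M - n * x) * h) ^ 2) := by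
    -- The vanishing term M S - M S is inserted so that one copy can become the sum of w j · j,
    -- which makes the identity hold termwise.
    have e1 : κ * S * (h ^ 2 * V + ((M - n * x) * h) ^ 2)
        = κ * h ^ 2 * (V * S + 2 * (M - n * x) * (M * S - M * S) + (M - n * x) ^ 2 * S) := by ring
    have e2 : 2 * (M - n * x) * (M * S - M * S)
        = 2 * (M - n * x) * (∑ j ∈ Finset.range (n + 1), w j * j - M * S) := by rw [← hM]
    rw [e1, e2, hV, hS, Finset.mul_sum, Finset.mul_sum, ← Finset.sum_sub_distrib, Finset.mul_sum,
      ← Finset.sum_add_distrib, ← Finset.sum_add_distrib, Finset.mul_sum]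
    exact Finset.sum_congr rfl fun j _ => by ring
  have hκS : κ * S ≠ 0 := (mul_pos hκ hS0).ne'
  obtain ⟨hv0, hfin⟩ := hmain h (fun j => ((j : ℝ) - n * x) * h) (fun j => κ * w j) (n + 1) hh0 hhle
    (fun j => by push_cast; ring)
    (by
      have : -(β * min x (1 - x) / h) = -(n * min x (1 - x)) * h := by
        field_simp
        rw [hh2]
        field_simp
      rw [this]
      refine mul_le_mul_of_nonneg_right ?_ hh0.le
      have := mul_le_mul_of_nonneg_left (min_le_left x (1 - x)) hn.le
      push_cast
      linarith)
    (by
      have : β * min x (1 - x) / h = (n * min x (1 - x)) * h := by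
        field_simp
        rw [hh2]
        field_simp
      rw [this]
      refine mul_le_mul_of_nonneg_right ?_ hh0.le
      have := mul_le_mul_of_nonneg_left (min_le_right x (1 - x)) hn.le
      push_cast
      linarith)
    (fun j hj => hW h rfl j (by omega))
    ((M - n * x) * h) (h ^ 2 * V)
    (by rw [hsum0, hsum1, mul_div_cancel_left₀ _ hκS])
    (by rw [hsum0, hsum2, mul_div_cancel_left₀ _ hκS]; ring)
  have hV0 : 0 < V := by
    by_contra hneg
    nlinarith [mul_nonneg (sq_nonneg h) (neg_nonneg.2 (not_lt.1 hneg))]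
  have hsV : 0 < Real.sqrt V := Real.sqrt_pos.2 hV0
  have hmeas : MeasurableSet {y : ℝ | (y - M) / Real.sqrt V ≤ z} :=
    measurableSet_le (by fun_prop) measurable_const
  rw [measureReal_fracBinom hα hx n hmeas, ← hw, ← hS, ← hbound]
  refine le_of_eq_of_le ?_ (hfin z)
  rw [hsum0, ← Finset.mul_sum, mul_div_mul_left _ _ hκ.ne', Real.sqrt_mul (sq_nonneg h),
    Real.sqrt_sq hh0.le]
  -- Standardization is invariant under the affine map y ↦ (y - nx)h, so both sums run over the same
  -- indices.
  congr 4
  refine Finset.filter_congr fun j _ => ?_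
  rw [div_le_iff₀ hsV, show (M - n * x) * h + z * (h * Real.sqrt V)
    = (M + z * Real.sqrt V - n * x) * h by ring, mul_le_mul_iff_left₀ hh0]
  constructor <;> intro _ <;> linarith

theorem theorem2p5 (α x : ℝ) (hα : 0 < α) (hx : x ∈ Set.Ioo (0 : ℝ) 1) :
    ∃ C : ℝ, 0 < C ∧
      ∀ n : ℕ, 1 ≤ n →
        ∀ (Ω : Type*) [MeasurableSpace Ω] (P : Measure Ω) [IsProbabilityMeasure P] (S : Ω → ℝ),
          HasLaw S (fracBinom α x n) P →
            ∀ z : ℝ,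
              |P.real {ω | (S ω - ∫ ω', S ω' ∂P) / Real.sqrt (variance S P) ≤ z}
                  - stdNormalCDF z| ≤ C / Real.sqrt n := by
  obtain ⟨C, hC, N, hN⟩ := fracBinom_berryEsseen_of_large hα hx
  -- For n ≤ N the summand √N makes the bound at least 1, which any two numbers in [0, 1] satisfy.
  refine ⟨C + Real.sqrt N, by positivity, fun n hn Ω _ P _ S hS z => ?_⟩
  have hn0 : 0 < Real.sqrt n := Real.sqrt_pos.2 (by exact_mod_cast hn)
  rcases le_total N n with h | h
  · set M := ∫ ω', S ω' ∂P with hM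
    have hmeas : MeasurableSet {y : ℝ | (y - M) / Real.sqrt (variance S P) ≤ z} :=
      measurableSet_le (by fun_prop) measurable_const
    have hM' : M = ∫ y, y ∂fracBinom α x n := hS.integral_eq
    have hV : variance S P = ∫ y, (y - M) ^ 2 ∂fracBinom α x n := by
      rw [hS.variance_eq, variance_eq_integral aemeasurable_id, hM']
      rfl
    rw [hS.measureReal_eq hmeas]
    refine (hN n h M _ hM' hV z).trans ?_
    gcongr
    linarith [Real.sqrt_nonneg (N : ℝ)]
  · have h1 : (1 : ℝ) ≤ (C + Real.sqrt N) / Real.sqrt n := by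
      rw [le_div_iff₀ hn0, one_mul]
      have : Real.sqrt n ≤ Real.sqrt N := Real.sqrt_le_sqrt (by exact_mod_cast h)
      linarith
    refine le_trans ?_ h1
    have h2 := stdNormalCDF_nonneg z
    have h3 := stdNormalCDF_le_one z
    have h4 : P.real {ω | (S ω - ∫ ω', S ω' ∂P) / Real.sqrt (variance S P) ≤ z} ≤ 1 :=
      measureReal_le_one
    have h5 := measureReal_nonneg (μ := P)
      (s := {ω | (S ω - ∫ ω', S ω' ∂P) / Real.sqrt (variance S P) ≤ z})
    rw [abs_le]
    constructor <;> linarith
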